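/- **Theorem (perturbation of linear forms of eigenvectors, rank $r$).** There are universal constants $c_1, C, K > 0$ such that the following holds for all integers $1\le r\le n$. Let $M^\star\in\mathbb R^{n\times n}$ be a symmetric matrix of rank $r$ with $M^\star=\sum_{j=1}^r\lambda_j^\star u_j^\star u_j^{\star\top}$, where $u_1^\star,\dots,u_r^\star$ are orthonormal and $|\lambda_1^\star|\ge\dots\ge|\lambda_r^\star|>0$. Put $\lambda^\star_{\max}=\max_j|\lambda_j^\star|$, $\lambda^\star_{\min}=\min_j|\lambda_j^\star|$, $\kappa=\lambda^\star_{\max}/\lambda^\star_{\min}$. Let $M^\star$ be incoherent with parameter $\mu$, i.e. every entry of every $u_j^\star$ is at most $\sqrt{\mu/n}$ in absolute value. Let $H$ be a random $n\times n$ real matrix whose $n^2$ entries are independent with $\mathbb E H_{ij}=0$, $\operatorname{Var}(H_{ij})\le\sigma^2$ (where $\sigma\ge 0$) and $|H_{ij}|\le B$ almost surely. Let $M=M^\star+H$, let $\lambda_1,\dots,\lambda_n\in\mathbb C$ be its eigenvalues, repeated with algebraic multiplicity and ordered so that $|\lambda_1|\ge\dots\ge|\lambda_n|$, and for $1\le \ell\le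 r$ let $u_\ell\in\mathbb C^n$ be a right eigenvector of $M$ for $\lambda_\ell$ with $\|u_\ell\|_2=1$. Suppose that $$\frac{\max\{\sigma\sqrt{n\log n},\,B\log n\}}{\lambda^\star_{\max}}\le\frac{c_1}{\kappa}.$$ Then for every fixed unit vector $a\in\mathbb R^n$ and every $1\le\ell\le r$, with probability at least $1-Kn^{-10}$ (for every admissible ordering of the eigenvalues and choice of $u_\ell$ simultaneously), one has $\lambda_\ell\ne0$, $$\left|a^\top\Big(u_\ell-\sum_{j=1}^r\frac{\lambda_j^\star\,u_j^{\star\top}u_\ell}{\lambda_\ell}\,u_j^\star\Big)\right|\le C\max\{\sigma\sqrt{n\log n},\,B\log n\}\,\frac{\kappa}{|\lambda_\ell|}\sqrt{\frac{\mu r}{n}},$$ and $$\max\{\sigma\sqrt{n\log n},\,B\log n\}\,\frac{\kappa}{|\lambda_\ell|}\sqrt{\frac{\mu r}{n}}\le C\,\frac{\max\{\sigma\sqrt{n\log n},\,B\log n\}}{\lambda^\star_{\max}}\,\kappa^2\sqrt{\frac{\mu r}{n}}.$$ -/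

import Mathlib

open MeasureTheory ProbabilityTheory

namespace AsymPert

/-- The nonzero part of the spectral decomposition of a real symmetric matrix: `M = ∑ j, lam j • u j (u j)ᵀ`
with orthonormal eigenvectors `u j` and nonzero eigenvalues ordered by decreasing modulus. -/
structure IsEigenDecomp {n r : ℕ} (M : Matrix (Fin n) (Fin n) ℝ) (lam : Fin r → ℝ)
    (u : Fin r → EuclideanSpace ℝ (Fin n)) : Prop where
  orthonormal : Orthonormal ℝ u
  ne_zero : ∀ j, lam j ≠ 0
  antitone : Antitone fun j => |lam j|
  eq_sum : ∀ i k, M i k = ∑ j, lam j * u j i * u j k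

/-- The largest modulus of the nonzero eigenvalues. -/
noncomputable def lamMax {r : ℕ} (lam : Fin r → ℝ) : ℝ := ⨆ j, |lam j|

/-- The smallest modulus of the nonzero eigenvalues. -/
noncomputable def lamMin {r : ℕ} (lam : Fin r → ℝ) : ℝ := ⨅ j, |lam j|

/-- The condition number of the low-rank matrix. -/
noncomputable def cond {r : ℕ} (lam : Fin r → ℝ) : ℝ := lamMax lam / lamMin lam

/-- Incoherence with parameter `μ`: every entry of the matrix `U = [u 0, …, u (r - 1)]` is at most
`√(μ / n)` in absolute value. -/
def IsIncoherent {n r : ℕ} (u : Fin r → EuclideanSpace ℝ (Fin n)) (μ : ℝ) : Prop :=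
  ∀ j i, |u j i| ≤ √(μ / n)

/-- The noise model: all `n ^ 2` entries of `H` are independent, centered, of variance at most
`σ ^ 2`, and bounded by `B`. -/
structure IsNoise {n : ℕ} {Ω : Type*} [MeasurableSpace Ω] (P : Measure Ω)
    (H : Ω → Matrix (Fin n) (Fin n) ℝ) (σ B : ℝ) : Prop where
  measurable : ∀ i j, Measurable fun ω => H ω i j
  indep : iIndepFun (fun (p : Fin n × Fin n) ω => H ω p.1 p.2) P
  mean_zero : ∀ i j, ∫ ω, H ω i j ∂P = 0
  variance_le : ∀ i j, variance (fun ω => H ω i j) P ≤ σ ^ 2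
  bounded : ∀ i j, ∀ᵐ ω ∂P, |H ω i j| ≤ B

/-- The noise level `max {σ √(n log n), B log n}`. -/
noncomputable def noiseLevel (n : ℕ) (σ B : ℝ) : ℝ :=
  max (σ * √(n * Real.log n)) (B * Real.log n)

/-- `lam` lists all `n` complex eigenvalues of the real matrix `M`, with algebraic multiplicity,
by decreasing modulus. -/
def IsEigenvalueList {n : ℕ} (M : Matrix (Fin n) (Fin n) ℝ) (lam : Fin n → ℂ) : Prop :=
  (M.map Complex.ofReal).charpoly.roots = Multiset.map lam Finset.univ.val ∧
    Antitone fun i => ‖lam i‖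

/-- `u` is a unit-norm (right) eigenvector of `M`, possibly complex, for the eigenvalue `z`. -/
def IsUnitEigenvector {n : ℕ} (M : Matrix (Fin n) (Fin n) ℝ) (z : ℂ)
    (u : EuclideanSpace ℂ (Fin n)) : Prop :=
  ‖u‖ = 1 ∧ ∀ i, ∑ k, (M i k : ℂ) * u k = z * u i

/-- The linear form `aᵀ (u - ∑ j, (lamS j * (uS j)ᵀ u / z) uS j)`. -/
noncomputable def linForm {n r : ℕ} (a : EuclideanSpace ℝ (Fin n)) (lamS : Fin r → ℝ)
    (uS : Fin r → EuclideanSpace ℝ (Fin n)) (z : ℂ) (u : EuclideanSpace ℂ (Fin n)) : ℂ :=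
  ∑ i, (a i : ℂ) * (u i - ∑ j, ((lamS j : ℂ) * (∑ k, (uS j k : ℂ) * u k) / z) * (uS j i : ℂ))

end AsymPert

/-! Write L for the noise level and T = 1800 L. The eigenvector equation reads z u = ∑ j, λ*_j
(u*_jᵀ u) u*_j + H u. Substituting it into itself p + 1 times turns the linear form into ∑
z^{-(s+2)} λ*_j (u*_jᵀ u) aᵀ H^{s+1} u*_j over j and s < p, plus the remainder z^{-(p+1)} aᵀ H^{p+1}
u (`norm_linForm_le`). Cauchy–Schwarz bounds ∑ j, |u*_jᵀ u| by √r. So the claim follows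
deterministically from three facts: |z| is at least half the least |λ*_j|, hence at least 3T; ‖H‖ ≤
T; and |aᵀ H^{s+1} u*_j| ≤ √(μ/n) T^{s+1} for all s < p. With p = ⌈log n⌉ the series is geometric,
and the factor 3^{-p} ≤ 1/n ≤ √(μ/n) absorbs the remainder.

The last two facts come from high moments. The m-th moment of aᵀ H^{s+1} b is a sum over m-tuples of
walks of s + 1 steps. Independence kills every tuple in which some ordered pair is used exactly
once, and any other tuple contributes at most B^{m(s+1)} q^{#distinct edges}, with q = σ²/B².
Exploring the walks edge by edge, a step costs D = nq + N, where N bounds the number of edges: a new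
edge has at most n endpoints at price q, an old one is among N. Enlarging B to L / log n makes nq at
most log n, so with N of order log n each step costs B D ≤ 50 L (`noiseLevel_scale`). For the trace
of a power of H Hᵀ this is already enough and gives ‖H‖ (`integral_trace_le`).

For the bilinear form the starting points also have to be summed, and ∑ |a i| can be as large as √n.
The loss is avoided because the first edge of each walk must recur. If it recurs in the same walk,
the walk returns to its start, and the closing edge pays for the free starting point
(`sum_returns_le`). If it recurs in another walk, one walk has a prescribed edge, hence no free
starting point, and the arithmetic-geometric mean inequality leaves only ∑ a² ≤ 1 for the other
(`sum_allLinked_le`, `integral_bilin_pow_le`). It matters that (i, j) and (j, i) are independent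
entries: going back and forth along a pair is not a repetition.

Since M is not normal, the bound on |z| is dynamical (`card_large_roots`): M preserves and expands a
cone around the span of the u*_j, whereas orbits in the generalized eigenspaces of small eigenvalues
grow too slowly. Comparing dimensions, at least r eigenvalues, with multiplicity, are large. -/

namespace AsymPert

/-! ### Counting walks by their number of distinct edges -/

/-- Exploring one more edge: an old edge costs `1`, a new one costs `q`. -/
lemma sum_pow_card_insert_le {ι E : Type*} [Fintype ι] [DecidableEq E] {q : ℝ} (hq : 0 ≤ q)
    (F : ι → E) (hF : Function.Injective F) (O : Finset E) :
    ∑ i, q ^ (insert (F i) O).card ≤ (Fintype.card ι * q + O.card) * q ^ O.card := by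
  have h1 : ∀ i, q ^ (insert (F i) O).card ≤ (q + if F i ∈ O then 1 else 0) * q ^ O.card := by
    intro i
    by_cases h : F i ∈ O
    · rw [Finset.insert_eq_of_mem h, if_pos h]
      nlinarith [mul_nonneg hq (pow_nonneg hq O.card)]
    · rw [Finset.card_insert_of_notMem h, if_neg h, pow_succ]
      linarith
  refine (Finset.sum_le_sum fun i _ => h1 i).trans ?_
  rw [← Finset.sum_mul, Finset.sum_add_distrib]
  refine mul_le_mul_of_nonneg_right ?_ (pow_nonneg hq _)
  have h2 : (Finset.univ.filter fun i => F i ∈ O).card ≤ O.card :=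
    Finset.card_le_card_of_injOn F (fun i hi => by simpa using hi) hF.injOn
  have h3 : ((Finset.univ.filter fun i => F i ∈ O).card : ℝ) ≤ O.card := by exact_mod_cast h2
  simp only [Finset.sum_const, Finset.card_univ, nsmul_eq_mul, Finset.sum_boole]
  linarith

/-- The edges of a walk, where the step from time `t` to time `t + 1` from `u` to `v` uses the edge
`ed t u v`. -/
def walkSupp {V E : Type*} [DecidableEq E] (ed : ℕ → V → V → E) {s : ℕ} (w : Fin (s + 1) → V) :
    Finset E :=
  Finset.univ.image fun t : Fin s => ed t (w t.castSucc) (w t.succ)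

lemma card_walkSupp_le {V E : Type*} [DecidableEq E] (ed : ℕ → V → V → E) {s : ℕ}
    (w : Fin (s + 1) → V) : (walkSupp ed w).card ≤ s :=
  Finset.card_image_le.trans (by simp)

lemma walkSupp_zero {V E : Type*} [DecidableEq E] (ed : ℕ → V → V → E) (w : Fin 1 → V) :
    walkSupp ed w = ∅ := by
  simp [walkSupp]

lemma walkSupp_snoc {V E : Type*} [DecidableEq E] (ed : ℕ → V → V → E) {s : ℕ}
    (w : Fin (s + 1) → V) (v : V) :
    walkSupp ed (Fin.snoc w v : Fin (s + 2) → V) =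
      insert (ed s (w (Fin.last s)) v) (walkSupp ed w) := by
  ext e
  simp only [walkSupp, Finset.mem_image, Finset.mem_univ, true_and, Finset.mem_insert]
  rw [Fin.exists_fin_succ']
  simp only [Fin.succ_last, Fin.snoc_last, Fin.snoc_castSucc, Fin.val_castSucc, Fin.val_last,
    Fin.succ_castSucc]
  constructor
  · rintro (h | h)
    · exact Or.inr h
    · exact Or.inl h.symm
  · rintro (h | h)
    · exact Or.inr h.symm
    · exact Or.inl h

lemma walkSupp_cons {V E : Type*} [DecidableEq E] (ed : V → V → E) {s : ℕ}
    (w : Fin (s + 1) → V) (v : V) :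
    walkSupp (fun _ => ed) (Fin.cons v w : Fin (s + 2) → V) =
      insert (ed v (w 0)) (walkSupp (fun _ => ed) w) := by
  ext e
  simp only [walkSupp, Finset.mem_image, Finset.mem_univ, true_and, Finset.mem_insert]
  rw [Fin.exists_fin_succ]
  simp only [Fin.castSucc_zero, Fin.cons_zero, Fin.cons_succ, ← Fin.succ_castSucc]
  exact or_congr_left eq_comm

lemma sum_snoc {V M : Type*} [Fintype V] [AddCommMonoid M] {s : ℕ} (f : (Fin (s + 1) → V) → M) :
    ∑ w, f w = ∑ w : Fin s → V, ∑ v, f (Fin.snoc w v) := by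
  rw [← Fintype.sum_prod_type', ← (Equiv.prodComm V (Fin s → V)).sum_comp]
  exact ((Fin.snocEquiv fun _ => V).sum_comp f).symm

lemma sum_cons {V M : Type*} [Fintype V] [AddCommMonoid M] {s : ℕ} (f : (Fin (s + 1) → V) → M) :
    ∑ w, f w = ∑ w : Fin s → V, ∑ v, f (Fin.cons v w) := by
  rw [← Fintype.sum_prod_type', ← (Equiv.prodComm V (Fin s → V)).sum_comp]
  exact ((Fin.consEquiv fun _ => V).sum_comp f).symm

/-- The set `O` holds the edges explored before this walk and `N` bounds all edges ever seen, so the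
same factor serves every step. The weight `Φ` ignores the new vertex, which lets the steps be
stripped off one at a time. -/
lemma sum_walk_snoc_le {V E : Type*} [Fintype V] [DecidableEq E] {q : ℝ} (hq : 0 ≤ q)
    (ed : ℕ → V → V → E) (hed : ∀ t u, Function.Injective (ed t u)) {s N : ℕ} (O : Finset E)
    (hO : O.card + s ≤ N) (Φ : (Fin (s + 1) → V) → ℝ) (hΦ : ∀ w, 0 ≤ Φ w) :
    ∑ w : Fin (s + 2) → V, Φ (Fin.init w) * q ^ (O ∪ walkSupp ed w).card ≤
      (Fintype.card V * q + N) * ∑ w, Φ w * q ^ (O ∪ walkSupp ed w).card := by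
  rw [sum_snoc, Finset.mul_sum]
  refine Finset.sum_le_sum fun w _ => ?_
  simp only [Fin.init_snoc, walkSupp_snoc, Finset.union_insert, ← Finset.mul_sum]
  have h1 := sum_pow_card_insert_le hq _ (hed s (w (Fin.last s))) (O ∪ walkSupp ed w)
  have h2 : ((O ∪ walkSupp ed w).card : ℝ) ≤ N := by
    exact_mod_cast (Finset.card_union_le _ _).trans
      ((Nat.add_le_add_left (card_walkSupp_le ed w) _).trans hO)
  calc _ ≤ Φ w * ((Fintype.card V * q + N) * q ^ (O ∪ walkSupp ed w).card) := by
        refine mul_le_mul_of_nonneg_left (h1.trans ?_) (hΦ w)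
        gcongr
    _ = _ := by ring

lemma sum_walk_cons_le {V E : Type*} [Fintype V] [DecidableEq E] {q : ℝ} (hq : 0 ≤ q)
    (ed : V → V → E) (hed : ∀ v, Function.Injective fun u => ed u v) {s N : ℕ} (O : Finset E)
    (hO : O.card + s ≤ N) (Φ : (Fin (s + 1) → V) → ℝ) (hΦ : ∀ w, 0 ≤ Φ w) :
    ∑ w : Fin (s + 2) → V, Φ (Fin.tail w) * q ^ (O ∪ walkSupp (fun _ => ed) w).card ≤
      (Fintype.card V * q + N) * ∑ w, Φ w * q ^ (O ∪ walkSupp (fun _ => ed) w).card := by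
  rw [sum_cons, Finset.mul_sum]
  refine Finset.sum_le_sum fun w _ => ?_
  simp only [Fin.tail_cons, walkSupp_cons, Finset.union_insert, ← Finset.mul_sum]
  have h1 := sum_pow_card_insert_le hq _ (hed (w 0)) (O ∪ walkSupp (fun _ => ed) w)
  have h2 : ((O ∪ walkSupp (fun _ => ed) w).card : ℝ) ≤ N := by
    exact_mod_cast (Finset.card_union_le _ _).trans
      ((Nat.add_le_add_left (card_walkSupp_le _ w) _).trans hO)
  calc _ ≤ Φ w * ((Fintype.card V * q + N) * q ^ (O ∪ walkSupp (fun _ => ed) w).card) := by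
        refine mul_le_mul_of_nonneg_left (h1.trans ?_) (hΦ w)
        gcongr
    _ = _ := by ring

/-- Walks with weighted starting point. -/
lemma sum_walk_le {V E : Type*} [Fintype V] [DecidableEq E] {q : ℝ} (hq : 0 ≤ q)
    (ed : ℕ → V → V → E) (hed : ∀ t u, Function.Injective (ed t u)) {s N : ℕ} (O : Finset E)
    (hO : O.card + s ≤ N) (φ : V → ℝ) (hφ : ∀ v, 0 ≤ φ v) :
    ∑ w : Fin (s + 1) → V, φ (w 0) * q ^ (O ∪ walkSupp ed w).card ≤
      (Fintype.card V * q + N) ^ s * ((∑ v, φ v) * q ^ O.card) := by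
  induction s with
  | zero =>
    simp only [walkSupp_zero, Finset.union_empty, ← Finset.sum_mul, pow_zero, one_mul]
    rw [← (Equiv.funUnique (Fin 1) V).symm.sum_comp]
    simp
  | succ s ih =>
    have h := sum_walk_snoc_le hq ed hed O (N := N) (s := s) (by omega) (fun w => φ (w 0))
      fun w => hφ _
    refine h.trans ?_
    rw [pow_succ', mul_assoc]
    exact mul_le_mul_of_nonneg_left (ih (by omega)) (by positivity)

/-- Walks with a prescribed edge at a prescribed time. -/
lemma sum_walk_edge_le {V E : Type*} [Fintype V] [DecidableEq V] [DecidableEq E] {q : ℝ}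
    (hq : 0 ≤ q) (hq1 : q ≤ 1)
    (ed : V → V → E) (hed : ∀ u, Function.Injective (ed u))
    (hed' : ∀ v, Function.Injective fun u => ed u v) {s N : ℕ} (O : Finset E)
    (hO : O.card + (s + 1) ≤ N) (t : Fin (s + 1)) (u v : V) :
    ∑ w : Fin (s + 2) → V, (if w t.castSucc = u ∧ w t.succ = v then 1 else 0) *
        q ^ (O ∪ walkSupp (fun _ => ed) w).card ≤
      (Fintype.card V * q + N) ^ s * q ^ O.card := by
  induction s with
  | zero =>
    obtain rfl : t = 0 := Fin.ext (by omega)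
    rw [Finset.sum_eq_single ![u, v]]
    · simp only [pow_zero, one_mul]
      refine (mul_le_of_le_one_left (pow_nonneg hq _) (by split_ifs <;> simp)).trans ?_
      exact pow_le_pow_of_le_one hq hq1 (Finset.card_le_card Finset.subset_union_left)
    · intro w _ hw
      rw [if_neg, zero_mul]
      rintro ⟨h0, h1⟩
      apply hw
      ext i
      fin_cases i
      · exact h0
      · exact h1
    · simp
  | succ s ih =>
    rw [pow_succ', mul_assoc]
    have hD : (0 : ℝ) ≤ Fintype.card V * q + N := by positivity
    -- The walk grows outwards from the prescribed edge: a last step is stripped while the edge is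
    -- not last, and a first step otherwise. The prescribed edge itself costs at most 1.
    rcases Fin.eq_castSucc_or_eq_last t with ⟨t, rfl⟩ | rfl
    · refine le_trans (le_of_eq ?_) ((sum_walk_snoc_le hq (fun _ => ed) (fun _ => hed) O (N := N)
        (s := s + 1) (by omega)
        (fun w => if w t.castSucc = u ∧ w t.succ = v then 1 else 0)
        fun w => by positivity).trans (mul_le_mul_of_nonneg_left (ih (by omega) t) hD))
      rfl
    · refine le_trans (le_of_eq ?_) ((sum_walk_cons_le hq ed hed' O (N := N)
        (s := s + 1) (by omega)
        (fun w => if w (Fin.last s).castSucc = u ∧ w (Fin.last s).succ = v then 1 else 0)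
        fun w => by positivity).trans (mul_le_mul_of_nonneg_left (ih (by omega) (Fin.last s)) hD))
      rfl

/-! ### Walks returning to their starting point -/

/-- The walk is back at its starting point at time `t`, and not earlier. -/
def FirstReturn {V : Type*} {s : ℕ} (t : ℕ) (w : Fin (s + 1) → V) : Prop :=
  (∃ j : Fin (s + 1), j.val = t ∧ w j = w 0) ∧ ∀ j : Fin (s + 1), 0 < j.val → j.val < t → w j ≠ w 0

open Classical in
-- The free starting point would cost a factor `card V`, but the closing step has no freedom. Its
-- edge either lies in `O`, which leaves at most `N` starting points, or is new at price `q`;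
-- together this is the usual cost of one step. First returns are used because only then is the
-- closing edge unused by the walk itself.
lemma sum_firstReturn_self_le {V : Type*} [Fintype V] [DecidableEq V] {q : ℝ} (hq : 0 ≤ q) {t N : ℕ}
    (O : Finset (V × V)) (hO : O.card + (t + 1) ≤ N) :
    ∑ w : Fin (t + 2) → V, (if FirstReturn (t + 1) w then 1 else 0) *
        q ^ (O ∪ walkSupp (fun _ => Prod.mk) w).card ≤
      (Fintype.card V * q + N) ^ (t + 1) * q ^ O.card := by
  set D : ℝ := Fintype.card V * q + N with hD
  have hedi : ∀ (t : ℕ) (u : V), Function.Injective ((fun _ => Prod.mk : ℕ → V → V → V × V) t u) :=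
    fun _ u => Prod.mk_right_injective u
  have h1 : ∀ w : Fin (t + 1) → V, ∑ v, (if FirstReturn (t + 1) (Fin.snoc w v : Fin (t + 2) → V)
      then 1 else 0) * q ^ (O ∪ walkSupp (fun _ => Prod.mk) (Fin.snoc w v : Fin (t + 2) → V)).card ≤
      (q + if (w (Fin.last t), w 0) ∈ O then 1 else 0) *
        q ^ (O ∪ walkSupp (fun _ => Prod.mk) w).card := by
    intro w
    rw [Finset.sum_eq_single (w 0)]
    · rw [walkSupp_snoc, Finset.union_insert]
      split_ifs with hr hO1 hO1
      · rw [Finset.insert_eq_of_mem (Finset.mem_union_left _ hO1)]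
        nlinarith [mul_nonneg hq (pow_nonneg hq (O ∪ walkSupp (fun _ => Prod.mk) w).card)]
      · rw [Finset.card_insert_of_notMem, pow_succ]
        · linarith
        -- An earlier use of the closing edge would end at `w 0`, which is an earlier return.
        · intro hm
          rcases Finset.mem_union.1 hm with hm | hm
          · exact hO1 hm
          · obtain ⟨j, _, hj⟩ := Finset.mem_image.1 hm
            have := hr.2 j.succ.castSucc (by simp) (by simp)
            apply this
            rw [Fin.snoc_castSucc]
            exact (Prod.ext_iff.1 hj).2
      · rw [zero_mul]; positivity
      · rw [zero_mul]; positivity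
    · intro v _ hv
      rw [if_neg, zero_mul]
      rintro ⟨⟨j, hj, hj'⟩, -⟩
      obtain rfl : j = Fin.last (t + 1) := Fin.ext hj
      rw [Fin.snoc_last, ← Fin.castSucc_zero, Fin.snoc_castSucc] at hj'
      exact hv hj'
    · simp
  rw [sum_snoc]
  refine (Finset.sum_le_sum fun w _ => h1 w).trans ?_
  simp only [add_mul, Finset.sum_add_distrib, ← Finset.mul_sum]
  have h2 := sum_walk_le hq _ hedi O (N := N) (s := t) (by omega) (fun _ => 1) (by simp)
  simp only [one_mul, Finset.sum_const, Finset.card_univ, nsmul_eq_mul, mul_one] at h2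
  -- An old closing edge fixes the starting point as its second endpoint, so the sum runs over `O`
  -- instead of over `V`.
  have h3 : ∑ w : Fin (t + 1) → V, (if (w (Fin.last t), w 0) ∈ O then (1 : ℝ) else 0) *
        q ^ (O ∪ walkSupp (fun _ => Prod.mk) w).card ≤ N * (D ^ t * q ^ O.card) := by
    have h4 : ∀ e ∈ O, ∑ w : Fin (t + 1) → V, (if w 0 = e.2 then (1 : ℝ) else 0) *
        q ^ (O ∪ walkSupp (fun _ => Prod.mk) w).card ≤ D ^ t * q ^ O.card := by
      intro e _
      have := sum_walk_le hq _ hedi O (N := N) (s := t) (by omega)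
        (fun v => if v = e.2 then 1 else 0) (fun v => by positivity)
      simpa using this
    calc _ ≤ ∑ w : Fin (t + 1) → V, ∑ e ∈ O, (if w 0 = e.2 then (1 : ℝ) else 0) *
        q ^ (O ∪ walkSupp (fun _ => Prod.mk) w).card := by
          refine Finset.sum_le_sum fun w _ => ?_
          split_ifs with hw
          · refine le_trans (le_of_eq ?_) (Finset.single_le_sum (f := fun e =>
              (if w 0 = e.2 then (1 : ℝ) else 0) * q ^ (O ∪ walkSupp (fun _ => Prod.mk) w).card)
              (fun e _ => by positivity) hw)
            simp
          · rw [zero_mul]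
            exact Finset.sum_nonneg fun e _ => by positivity
      _ ≤ O.card * (D ^ t * q ^ O.card) := by
          rw [Finset.sum_comm, ← nsmul_eq_mul]
          exact Finset.sum_le_card_nsmul _ _ _ h4
      _ ≤ _ := by
          have : (O.card : ℝ) ≤ N := by exact_mod_cast (by omega)
          gcongr
  calc _ ≤ q * (D ^ t * (Fintype.card V * q ^ O.card)) + N * (D ^ t * q ^ O.card) :=
        add_le_add (mul_le_mul_of_nonneg_left h2 hq) h3
    _ = _ := by rw [pow_succ]; nth_rewrite 4 [hD]; ring

open Classical in
-- The event depends only on the walk up to time `t + 1`, so each later step contributes the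
-- ordinary factor.
lemma sum_firstReturn_le {V : Type*} [Fintype V] [DecidableEq V] {q : ℝ} (hq : 0 ≤ q) {s t N : ℕ}
    (hts : t + 1 ≤ s) (O : Finset (V × V)) (hO : O.card + s ≤ N) :
    ∑ w : Fin (s + 1) → V, (if FirstReturn (t + 1) w then 1 else 0) *
        q ^ (O ∪ walkSupp (fun _ => Prod.mk) w).card ≤
      (Fintype.card V * q + N) ^ s * q ^ O.card := by
  induction s, hts using Nat.le_induction with
  | base => exact sum_firstReturn_self_le hq O hO
  | succ s hs ih =>
    have hD : (0 : ℝ) ≤ Fintype.card V * q + N := by positivity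
    have h := (sum_walk_snoc_le hq (fun _ => Prod.mk) (fun _ u => Prod.mk_right_injective u) O
      (N := N) (s := s) (by omega) (fun w : Fin (s + 1) → V => if FirstReturn (t + 1) w then 1 else 0)
      (fun w => by positivity)).trans (mul_le_mul_of_nonneg_left (ih (by omega)) hD)
    rw [← mul_assoc, ← pow_succ'] at h
    refine le_trans (le_of_eq ?_) h
    refine Finset.sum_congr rfl fun w _ => ?_
    congr 1
    refine if_congr ?_ rfl rfl
    unfold FirstReturn
    refine and_congr ⟨?_, ?_⟩ ⟨?_, ?_⟩
    · rintro ⟨j, hj, hj'⟩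
      exact ⟨⟨j.val, by omega⟩, hj, hj'⟩
    · rintro ⟨j, hj, hj'⟩
      exact ⟨j.castSucc, hj, hj'⟩
    · intro h j h0 h1
      exact h j.castSucc h0 h1
    · intro h j h0 h1
      exact h ⟨j.val, by omega⟩ h0 h1

/-- The walk takes a second step from its starting point. -/
def Returns {V : Type*} {s : ℕ} (w : Fin (s + 1) → V) : Prop :=
  ∃ j : Fin s, 0 < j.val ∧ w j.castSucc = w 0

open Classical in
lemma sum_returns_le {V : Type*} [Fintype V] [DecidableEq V] {q : ℝ} (hq : 0 ≤ q) {s N : ℕ}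
    (O : Finset (V × V)) (hO : O.card + s ≤ N) :
    ∑ w : Fin (s + 1) → V, (if Returns w then 1 else 0) *
        q ^ (O ∪ walkSupp (fun _ => Prod.mk) w).card ≤
      s * (Fintype.card V * q + N) ^ s * q ^ O.card := by
  calc _ ≤ ∑ w : Fin (s + 1) → V, ∑ t : Fin s, (if FirstReturn (t.val + 1) w then 1 else 0) *
        q ^ (O ∪ walkSupp (fun _ => Prod.mk) w).card := by
        refine Finset.sum_le_sum fun w _ => ?_
        have hnn : ∀ t : Fin s, 0 ≤ (if FirstReturn (t.val + 1) w then 1 else 0) *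
          q ^ (O ∪ walkSupp (fun _ => Prod.mk) w).card := fun t => by positivity
        split_ifs with hr
        · obtain ⟨j, hj0, hj⟩ := hr
          have hex : ∃ t : ℕ, 0 < t ∧ ∃ j : Fin (s + 1), j.val = t ∧ w j = w 0 :=
            ⟨j, hj0, j.castSucc, rfl, hj⟩
          have hle : Nat.find hex ≤ j := Nat.find_min' hex ⟨hj0, j.castSucc, rfl, hj⟩
          obtain ⟨h0, h1⟩ := Nat.find_spec hex
          have hfr : FirstReturn (Nat.find hex - 1 + 1) w := by
            rw [Nat.sub_add_cancel h0]
            refine ⟨h1, fun i hi0 hi hw => Nat.find_min hex hi ⟨hi0, i, rfl, hw⟩⟩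
          refine le_trans (le_of_eq ?_) (Finset.single_le_sum (fun t _ => hnn t)
            (Finset.mem_univ (⟨Nat.find hex - 1, by omega⟩ : Fin s)))
          rw [if_pos hfr]
        · rw [zero_mul]
          exact Finset.sum_nonneg fun t _ => hnn t
    _ ≤ ∑ t : Fin s, (Fintype.card V * q + N) ^ s * q ^ O.card := by
        rw [Finset.sum_comm]
        exact Finset.sum_le_sum fun t _ => sum_firstReturn_le hq (by omega) O hO
    _ = _ := by simp [mul_assoc]

/-! ### Tuples of walks linked through their first edges -/

lemma sum_insertNth {V M : Type*} [Fintype V] [AddCommMonoid M] {s : ℕ} (j : Fin (s + 1))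
    (f : (Fin (s + 1) → V) → M) :
    ∑ w, f w = ∑ v, ∑ w : Fin s → V, f (j.insertNth v w) := by
  rw [← Fintype.sum_prod_type']
  exact ((Fin.insertNthEquiv (fun _ => V) j).sum_comp f).symm

/-- Every member of the tuple `v` is exceptional, or is linked to the environment `Z`, or to another
member. -/
def AllLinked {W : Type*} (ret : W → Prop) (link : W → W → Prop) {m : ℕ} (Z : Finset W)
    (v : Fin m → W) : Prop :=
  ∀ i, ret (v i) ∨ (∃ z ∈ Z, link z (v i)) ∨ ∃ j, j ≠ i ∧ link (v j) (v i)

/-- A member that was linked only to the one removed stays linked once that one joins the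
environment. This is why the environment `Z` is carried through the induction. -/
lemma AllLinked.of_insertNth {W : Type*} [DecidableEq W] {ret : W → Prop} {link : W → W → Prop}
    {m : ℕ} {Z : Finset W} {j : Fin (m + 1)} {p : W} {v : Fin m → W}
    (h : AllLinked ret link Z (j.insertNth p v : Fin (m + 1) → W)) :
    AllLinked ret link (insert p Z) v := by
  intro i
  have hi := h (j.succAbove i)
  rw [Fin.insertNth_apply_succAbove] at hi
  rcases hi with hi | ⟨z, hz, hzi⟩ | ⟨k, hk, hki⟩
  · exact Or.inl hi
  · exact Or.inr (Or.inl ⟨z, Finset.mem_insert_of_mem hz, hzi⟩)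
  · rcases Fin.eq_self_or_eq_succAbove j k with rfl | ⟨k, rfl⟩
    · rw [Fin.insertNth_apply_same] at hki
      exact Or.inr (Or.inl ⟨p, Finset.mem_insert_self _ _, hki⟩)
    · rw [Fin.insertNth_apply_succAbove] at hki
      exact Or.inr (Or.inr ⟨k, fun hk' => hk (hk' ▸ rfl), hki⟩)

/-- The weight of a tuple with exponent the number of distinct edges, beyond those in `O`. -/
noncomputable def tupleWeight {W E : Type*} [DecidableEq E] (q : ℝ) (supp : W → Finset E)
    (α : W → ℝ) {m : ℕ} (O : Finset E) (v : Fin m → W) : ℝ :=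
  (∏ i, α (v i)) * q ^ (O ∪ Finset.univ.biUnion fun i => supp (v i)).card

lemma tupleWeight_nonneg {W E : Type*} [DecidableEq E] {q : ℝ} (hq : 0 ≤ q) (supp : W → Finset E)
    {α : W → ℝ} (hα : ∀ w, 0 ≤ α w) {m : ℕ} (O : Finset E) (v : Fin m → W) :
    0 ≤ tupleWeight q supp α O v :=
  mul_nonneg (Finset.prod_nonneg fun _ _ => hα _) (pow_nonneg hq _)

lemma tupleWeight_insertNth {W E : Type*} [DecidableEq E] (q : ℝ) (supp : W → Finset E)
    (α : W → ℝ) {m : ℕ} (O : Finset E) (j : Fin (m + 1)) (p : W) (v : Fin m → W) :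
    tupleWeight q supp α O (j.insertNth p v : Fin (m + 1) → W) =
      α p * tupleWeight q supp α (O ∪ supp p) v := by
  unfold tupleWeight
  rw [Fin.prod_univ_succAbove _ j]
  simp only [Fin.insertNth_apply_same, Fin.insertNth_apply_succAbove]
  rw [mul_assoc]
  congr 4
  ext e
  simp only [Finset.mem_union, Finset.mem_biUnion, Finset.mem_univ, true_and, or_assoc]
  refine or_congr_right ?_
  constructor
  · rintro ⟨k, hk⟩
    rcases Fin.eq_self_or_eq_succAbove j k with rfl | ⟨k, rfl⟩
    · rw [Fin.insertNth_apply_same] at hk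
      exact Or.inl hk
    · rw [Fin.insertNth_apply_succAbove] at hk
      exact Or.inr ⟨k, hk⟩
  · rintro (hk | ⟨k, hk⟩)
    · exact ⟨j, by rwa [Fin.insertNth_apply_same]⟩
    · exact ⟨j.succAbove k, by rwa [Fin.insertNth_apply_succAbove]⟩

open Classical in
/-- Counting tuples in which every member is linked to another one. -/
lemma sum_allLinked_le {W E : Type*} [Fintype W] [DecidableEq E] {q : ℝ} (hq : 0 ≤ q)
    (supp : W → Finset E) {α : W → ℝ} (hα : ∀ w, 0 ≤ α w) (hα1 : ∀ w, α w ≤ 1)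
    (ret : W → Prop) (link : W → W → Prop) (hsymm : ∀ w w', link w w' → link w' w)
    {s N M : ℕ} (hsupp : ∀ w, (supp w).card ≤ s) {D A : ℝ} (hD0 : 0 ≤ D) (hA0 : 0 ≤ A)
    (hD : ∀ O : Finset E, O.card + s ≤ N → ∀ w, ∑ w', (if link w w' then 1 else 0) *
      q ^ (O ∪ supp w').card ≤ D * q ^ O.card)
    (hA : ∀ O : Finset E, O.card + s ≤ N → ∑ w, α w ^ 2 * q ^ (O ∪ supp w).card ≤ A * q ^ O.card)
    (hR : ∀ O : Finset E, O.card + s ≤ N → ∑ w, (if ret w then 1 else 0) *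
      q ^ (O ∪ supp w).card ≤ A * q ^ O.card) (m : ℕ) :
    ∀ (Z : Finset W) (O : Finset E), O.card + m * s ≤ N → Z.card + m ≤ M →
      ∑ v : Fin m → W, (if AllLinked ret link Z v then 1 else 0) * tupleWeight q supp α O v ≤
        (2 * (M * D + A)) ^ m * q ^ O.card := by
  -- Chosen so that (A + M D) X + M A D ≤ X²: removing one member costs A + M D, and removing a
  -- linked pair costs A D for each of at most M choices of the partner.
  set X : ℝ := 2 * (M * D + A) with hX
  have hX0 : 0 ≤ X := by positivity
  have hcard : ∀ (O : Finset E) (w : W), (O ∪ supp w).card ≤ O.card + s := fun O w =>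
    (Finset.card_union_le _ _).trans (Nat.add_le_add_left (hsupp w) _)
  have hins : ∀ (Z : Finset W) (w : W), (insert w Z).card ≤ Z.card + 1 := fun Z w =>
    Finset.card_insert_le _ _
  -- The removed member is exceptional or linked to the environment; its own weight is bounded by 1.
  have key1 : ∀ m : ℕ, (∀ (Z : Finset W) (O : Finset E), O.card + m * s ≤ N → Z.card + m ≤ M →
      ∑ v : Fin m → W, (if AllLinked ret link Z v then 1 else 0) * tupleWeight q supp α O v ≤
        X ^ m * q ^ O.card) → ∀ (Z : Finset W) (O : Finset E), O.card + (m + 1) * s ≤ N →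
      Z.card + (m + 1) ≤ M →
      ∑ p, ∑ v : Fin m → W, (if ret p ∨ ∃ z ∈ Z, link z p then 1 else 0) *
        ((if AllLinked ret link (insert p Z) v then 1 else 0) *
          (α p * tupleWeight q supp α (O ∪ supp p) v)) ≤ (A + M * D) * X ^ m * q ^ O.card := by
    intro m ih Z O hO hZ
    have hOs : O.card + s ≤ N := by nlinarith
    calc _ ≤ ∑ p, (if ret p ∨ ∃ z ∈ Z, link z p then 1 else 0) *
          (X ^ m * q ^ (O ∪ supp p).card) := by
          refine Finset.sum_le_sum fun p _ => ?_
          rw [← Finset.mul_sum]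
          refine mul_le_mul_of_nonneg_left ?_ (by positivity)
          have h1 := ih (insert p Z) (O ∪ supp p) (by have := hcard O p; nlinarith)
            (by have := hins Z p; omega)
          refine le_trans (Finset.sum_le_sum fun v _ => ?_) h1
          refine mul_le_mul_of_nonneg_left ?_ (by positivity)
          exact mul_le_of_le_one_left (tupleWeight_nonneg hq _ hα _ _) (hα1 p)
      _ ≤ ∑ p, ((if ret p then 1 else 0) * q ^ (O ∪ supp p).card * X ^ m +
          ∑ z ∈ Z, (if link z p then 1 else 0) * q ^ (O ∪ supp p).card * X ^ m) := by
          refine Finset.sum_le_sum fun p _ => ?_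
          have hnn : 0 ≤ ∑ z ∈ Z, (if link z p then 1 else 0) * q ^ (O ∪ supp p).card * X ^ m :=
            Finset.sum_nonneg fun z _ => by positivity
          have hnn' : 0 ≤ q ^ (O ∪ supp p).card * X ^ m := by positivity
          by_cases hr : ret p
          · rw [if_pos (Or.inl hr), if_pos hr]
            linarith
          · by_cases hz : ∃ z ∈ Z, link z p
            · rw [if_pos (Or.inr hz), if_neg hr]
              obtain ⟨z, hz, hzp⟩ := hz
              have := Finset.single_le_sum (f := fun z => (if link z p then 1 else 0) *
                q ^ (O ∪ supp p).card * X ^ m) (fun z _ => by positivity) hz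
              simp only [if_pos hzp] at this
              linarith
            · rw [if_neg (not_or.2 ⟨hr, hz⟩), if_neg hr]
              linarith
      _ ≤ A * q ^ O.card * X ^ m + ∑ z ∈ Z, D * q ^ O.card * X ^ m := by
          rw [Finset.sum_add_distrib, Finset.sum_comm, ← Finset.sum_mul]
          refine add_le_add ?_ (Finset.sum_le_sum fun z _ => ?_)
          · exact mul_le_mul_of_nonneg_right (hR O hOs) (by positivity)
          · rw [← Finset.sum_mul]
            exact mul_le_mul_of_nonneg_right (hD O hOs z) (by positivity)
      _ ≤ _ := by
          rw [Finset.sum_const, nsmul_eq_mul]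
          have : (Z.card : ℝ) ≤ M := by exact_mod_cast (by omega)
          have := mul_le_mul_of_nonneg_right this
            (by positivity : 0 ≤ D * q ^ O.card * X ^ m)
          linarith
  -- The removed member `p` is linked to another member `w` of the tuple, and both are removed. A
  -- weight bound of 1 on both would leave one of them unconstrained, so the weights are needed
  -- here.
  have key2 : ∀ m : ℕ, (∀ (Z : Finset W) (O : Finset E), O.card + m * s ≤ N → Z.card + m ≤ M →
      ∑ v : Fin m → W, (if AllLinked ret link Z v then 1 else 0) * tupleWeight q supp α O v ≤
        X ^ m * q ^ O.card) → ∀ (Z : Finset W) (O : Finset E), O.card + (m + 2) * s ≤ N →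
      Z.card + (m + 2) ≤ M →
      ∑ p, ∑ w, ∑ v : Fin m → W, (if link w p then 1 else 0) *
        ((if AllLinked ret link (insert w (insert p Z)) v then 1 else 0) *
          (α p * (α w * tupleWeight q supp α (O ∪ supp p ∪ supp w) v))) ≤
        A * D * X ^ m * q ^ O.card := by
    intro m ih Z O hO hZ
    have hOs : O.card + s ≤ N := by nlinarith
    have hhalf : ∑ p, ∑ w, (if link w p then 1 else 0) * (α p ^ 2 *
        q ^ (O ∪ supp p ∪ supp w).card) ≤ A * D * q ^ O.card := by
      calc _ ≤ ∑ p, α p ^ 2 * (D * q ^ (O ∪ supp p).card) := by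
            refine Finset.sum_le_sum fun p _ => ?_
            refine le_trans (le_of_eq ?_) (mul_le_mul_of_nonneg_left (hD (O ∪ supp p)
              (by have := hcard O p; nlinarith) p) (sq_nonneg _))
            rw [Finset.mul_sum]
            refine Finset.sum_congr rfl fun w _ => ?_
            rw [if_congr ⟨hsymm _ _, hsymm _ _⟩ rfl rfl]
            ring
        _ = D * ∑ p, α p ^ 2 * q ^ (O ∪ supp p).card := by
            rw [Finset.mul_sum]
            exact Finset.sum_congr rfl fun p _ => by ring
        _ ≤ D * (A * q ^ O.card) := mul_le_mul_of_nonneg_left (hA O hOs) hD0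
        _ = _ := by ring
    have hhalf' : ∑ p, ∑ w, (if link w p then 1 else 0) * (α w ^ 2 *
        q ^ (O ∪ supp p ∪ supp w).card) ≤ A * D * q ^ O.card := by
      rw [Finset.sum_comm]
      refine le_trans (le_of_eq ?_) hhalf
      refine Finset.sum_congr rfl fun p _ => Finset.sum_congr rfl fun w _ => ?_
      rw [if_congr ⟨hsymm _ _, hsymm _ _⟩ rfl rfl, Finset.union_right_comm]
    calc _ ≤ ∑ p, ∑ w, (if link w p then 1 else 0) * (α p * α w *
          (X ^ m * q ^ (O ∪ supp p ∪ supp w).card)) := by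
          refine Finset.sum_le_sum fun p _ => Finset.sum_le_sum fun w _ => ?_
          rw [← Finset.mul_sum]
          refine mul_le_mul_of_nonneg_left ?_ (by positivity)
          have h1 := ih (insert w (insert p Z)) (O ∪ supp p ∪ supp w)
            (by have := hcard O p; have := hcard (O ∪ supp p) w; nlinarith)
            (by have := hins Z p; have := hins (insert p Z) w; omega)
          refine le_trans (le_of_eq ?_) (mul_le_mul_of_nonneg_left h1
            (mul_nonneg (hα p) (hα w)))
          rw [Finset.mul_sum]
          exact Finset.sum_congr rfl fun v _ => by ring
      _ ≤ ∑ p, ∑ w, (X ^ m / 2 * ((if link w p then 1 else 0) * (α p ^ 2 *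
          q ^ (O ∪ supp p ∪ supp w).card)) + X ^ m / 2 * ((if link w p then 1 else 0) *
          (α w ^ 2 * q ^ (O ∪ supp p ∪ supp w).card))) := by
          refine Finset.sum_le_sum fun p _ => Finset.sum_le_sum fun w _ => ?_
          -- In each half, the member carrying the square is summed with `hA` and the other one
          -- through the link with `hD`.
          have h2 : α p * α w ≤ (α p ^ 2 + α w ^ 2) / 2 := by nlinarith [sq_nonneg (α p - α w)]
          have h3 : 0 ≤ (if link w p then 1 else 0) * (X ^ m *
            q ^ (O ∪ supp p ∪ supp w).card) := by positivity
          nlinarith [mul_le_mul_of_nonneg_right h2 h3]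
      _ = X ^ m / 2 * ∑ p, ∑ w, (if link w p then 1 else 0) * (α p ^ 2 *
          q ^ (O ∪ supp p ∪ supp w).card) + X ^ m / 2 * ∑ p, ∑ w, (if link w p then 1 else 0) *
          (α w ^ 2 * q ^ (O ∪ supp p ∪ supp w).card) := by
          simp only [Finset.sum_add_distrib, Finset.mul_sum]
      _ ≤ X ^ m / 2 * (A * D * q ^ O.card) + X ^ m / 2 * (A * D * q ^ O.card) := by
          gcongr
      _ = _ := by ring
  have split1 : ∀ (m : ℕ) (Z : Finset W) (p : W) (v : Fin m → W) (x : ℝ), 0 ≤ x →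
      (if AllLinked ret link Z (Fin.insertNth 0 p v : Fin (m + 1) → W) then 1 else 0) * x ≤
      (if ret p ∨ ∃ z ∈ Z, link z p then 1 else 0) *
        ((if AllLinked ret link (insert p Z) v then 1 else 0) * x) +
      ∑ j : Fin m, (if link (v j) p then 1 else 0) *
        ((if AllLinked ret link (insert p Z) v then 1 else 0) * x) := by
    intro m Z p v x hx
    have hnn : 0 ≤ ∑ j : Fin m, (if link (v j) p then 1 else 0) *
        ((if AllLinked ret link (insert p Z) v then 1 else 0) * x) :=
      Finset.sum_nonneg fun j _ => by positivity
    by_cases hl : AllLinked ret link Z (Fin.insertNth 0 p v : Fin (m + 1) → W)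
    · rw [if_pos hl, if_pos hl.of_insertNth]
      rw [if_pos hl.of_insertNth] at hnn
      have h0 := hl 0
      rw [Fin.insertNth_apply_same, ← or_assoc] at h0
      rcases h0 with h0 | ⟨j, hj, hjp⟩
      · rw [if_pos h0]; linarith
      · obtain ⟨j, rfl⟩ := Fin.exists_succAbove_eq hj
        rw [Fin.insertNth_apply_succAbove] at hjp
        have := Finset.single_le_sum (f := fun j => (if link (v j) p then (1 : ℝ) else 0) *
          (1 * x)) (fun j _ => by positivity) (Finset.mem_univ j)
        simp only [if_pos hjp] at this
        refine le_add_of_nonneg_of_le (by positivity) ?_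
        linarith
    · rw [if_neg hl, zero_mul]
      positivity
  -- Two steps, because treating member 0 uses up either one member or two.
  induction m using Nat.twoStepInduction with
  | zero =>
    intro Z O _ _
    simp only [pow_zero, one_mul, Finset.univ_unique, Finset.sum_singleton]
    refine (mul_le_of_le_one_left (tupleWeight_nonneg hq _ hα _ _) (by split_ifs <;> simp)).trans ?_
    simp [tupleWeight]
  | one =>
    intro Z O hO hZ
    rw [sum_insertNth 0]
    have h1 := key1 0 (by
      intro Z O _ _
      simp only [pow_zero, one_mul, Finset.univ_unique, Finset.sum_singleton]
      refine (mul_le_of_le_one_left (tupleWeight_nonneg hq _ hα _ _)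
        (by split_ifs <;> simp)).trans ?_
      simp [tupleWeight]) Z O (by simpa using hO) (by simpa using hZ)
    refine le_trans (Finset.sum_le_sum fun p _ => Finset.sum_le_sum fun v _ => ?_) (h1.trans ?_)
    · rw [← tupleWeight_insertNth q supp α O 0 p v]
      refine (split1 0 Z p v _ (tupleWeight_nonneg hq _ hα _ _)).trans ?_
      simp
    · have : 0 ≤ (A + M * D) * q ^ O.card := by positivity
      rw [pow_zero, pow_one, hX]
      linarith
  | more m ih ih' =>
    intro Z O hO hZ
    rw [sum_insertNth 0]
    have h1 := key1 (m + 1) ih' Z O hO hZ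
    have h2 := key2 m ih Z O hO hZ
    calc _ ≤ ∑ p, ∑ v : Fin (m + 1) → W, ((if ret p ∨ ∃ z ∈ Z, link z p then 1 else 0) *
        ((if AllLinked ret link (insert p Z) v then 1 else 0) *
          (α p * tupleWeight q supp α (O ∪ supp p) v)) +
        ∑ j : Fin (m + 1), (if link (v j) p then 1 else 0) *
        ((if AllLinked ret link (insert p Z) v then 1 else 0) *
          (α p * tupleWeight q supp α (O ∪ supp p) v))) := by
          refine Finset.sum_le_sum fun p _ => Finset.sum_le_sum fun v _ => ?_
          rw [← tupleWeight_insertNth q supp α O 0 p v]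
          exact split1 (m + 1) Z p v _ (tupleWeight_nonneg hq _ hα _ _)
      _ ≤ (A + M * D) * X ^ (m + 1) * q ^ O.card +
          ∑ j : Fin (m + 1), A * D * X ^ m * q ^ O.card := by
          simp only [Finset.sum_add_distrib]
          refine add_le_add h1 ?_
          rw [(Finset.sum_congr rfl fun p _ => Finset.sum_comm).trans Finset.sum_comm]
          refine Finset.sum_le_sum fun j _ => le_trans ?_ h2
          refine Finset.sum_le_sum fun p _ => ?_
          rw [sum_insertNth j]
          refine Finset.sum_le_sum fun w _ => Finset.sum_le_sum fun v _ => ?_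
          rw [Fin.insertNth_apply_same, tupleWeight_insertNth]
          refine mul_le_mul_of_nonneg_left ?_ (by positivity)
          have hnn : 0 ≤ α p * (α w * tupleWeight q supp α (O ∪ supp p ∪ supp w) v) :=
            mul_nonneg (hα _) (mul_nonneg (hα _) (tupleWeight_nonneg hq _ hα _ _))
          refine mul_le_mul_of_nonneg_right ?_ hnn
          split_ifs with h3 h4 h4
          · exact le_rfl
          · exact absurd h3.of_insertNth h4
          · exact zero_le_one
          · exact le_rfl
      _ ≤ _ := by
          rw [Finset.sum_const, Finset.card_univ, Fintype.card_fin, nsmul_eq_mul]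
          have hm : ((m + 1 : ℕ) : ℝ) ≤ M := by exact_mod_cast (by omega)
          have h4 : ((m + 1 : ℕ) : ℝ) * (A * D) ≤ M * (A * D) :=
            mul_le_mul_of_nonneg_right hm (by positivity)
          have h5 : (A + M * D) * X + M * (A * D) ≤ X ^ 2 := by
            have : 0 ≤ M * D := by positivity
            rw [hX]
            nlinarith [mul_nonneg this hA0, sq_nonneg (M * D), sq_nonneg A]
          have h6 : 0 ≤ X ^ m * q ^ O.card := by positivity
          have h7 := mul_le_mul_of_nonneg_right h5 h6
          have h8 := mul_le_mul_of_nonneg_right h4 h6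
          rw [pow_add X m 2, pow_succ X m]
          linarith

/-- The first edge of one walk occurs in the other. -/
def Linked {V : Type*} {s : ℕ} (w w' : Fin (s + 2) → V) : Prop :=
  ∃ t : Fin (s + 1), (w' t.castSucc = w 0 ∧ w' t.succ = w 1) ∨
    (w t.castSucc = w' 0 ∧ w t.succ = w' 1)

open Classical in
/-- Weighted count of tuples of walks in which every first edge occurs at least twice. -/
lemma sum_allLinked_walk_le {V : Type*} [Fintype V] [DecidableEq V] {q : ℝ} (hq : 0 ≤ q) (hq1 : q ≤ 1)
    {a : V → ℝ} (ha : ∀ v, 0 ≤ a v) (ha1 : ∀ v, a v ≤ 1) (ha2 : ∑ v, a v ^ 2 ≤ 1) (s m : ℕ) :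
    ∑ v : Fin m → (Fin (s + 2) → V), (if AllLinked Returns Linked ∅ v then 1 else 0) *
        tupleWeight q (walkSupp fun _ => Prod.mk) (fun w => a (w 0)) ∅ v ≤
      (6 * ((s + 1 : ℕ) : ℝ) * (Fintype.card V * q + (m * (s + 1) : ℕ)) ^ (s + 1)) ^ m := by
  set N := m * (s + 1) with hN
  set D₀ : ℝ := Fintype.card V * q + N with hD₀
  have hD₀0 : 0 ≤ D₀ := by positivity
  have hedi : ∀ u : V, Function.Injective (Prod.mk u : V → V × V) := fun u =>
    Prod.mk_right_injective u
  have hedi' : ∀ v : V, Function.Injective fun u : V => (u, v) := fun v =>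
    Prod.mk_left_injective v
  have hedge : ∀ O : Finset (V × V), O.card + (s + 1) ≤ N → ∀ t x y,
      ∑ w : Fin (s + 2) → V, (if w (Fin.castSucc t) = x ∧ w t.succ = y then 1 else 0) *
        q ^ (O ∪ walkSupp (fun _ => Prod.mk) w).card ≤ D₀ ^ s * q ^ O.card := fun O hO t x y =>
    sum_walk_edge_le hq hq1 Prod.mk hedi hedi' O hO t x y
  -- `D` counts the `s + 1` positions of the shared edge and the two directions of the link, with
  -- `s` free steps left. `A` needs all `s + 1` steps; its factor `s + 1` comes from the possible
  -- times of the first return.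
  have h := sum_allLinked_le hq (walkSupp (V := V) (s := s + 1) fun _ => Prod.mk)
    (α := fun w => a (w 0)) (fun w => ha _) (fun w => ha1 _) Returns Linked
    (fun w w' ⟨t, ht⟩ => ⟨t, ht.symm⟩) (N := N) (M := m) (fun w => card_walkSupp_le _ w)
    (D := 2 * (s + 1 : ℕ) * D₀ ^ s) (A := (s + 1 : ℕ) * D₀ ^ (s + 1)) (by positivity)
    (by positivity) ?_ ?_ ?_ m ∅ ∅ (by simp [hN]) (by simp)
  · rw [Finset.card_empty, pow_zero, mul_one] at h
    refine h.trans (pow_le_pow_left₀ (by positivity) ?_ m)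
    -- As `N = m * (s + 1)` is part of `D₀`, the factor `M` in front of `D` is paid for by the step
    -- that the link saves.
    have h1 : ((m : ℝ) * (s + 1 : ℕ)) ≤ D₀ := by
      rw [hD₀, hN]
      push_cast
      have : 0 ≤ (Fintype.card V : ℝ) * q := by positivity
      linarith
    have h2 := mul_le_mul_of_nonneg_right h1 (pow_nonneg hD₀0 s)
    have h3 : D₀ * D₀ ^ s ≤ (s + 1 : ℕ) * (D₀ * D₀ ^ s) :=
      le_mul_of_one_le_left (by positivity) (by norm_num)
    rw [pow_succ']
    linarith
  · intro O hO w
    calc _ ≤ ∑ w' : Fin (s + 2) → V, ∑ t : Fin (s + 1),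
        ((if w' t.castSucc = w 0 ∧ w' t.succ = w 1 then 1 else 0) *
          q ^ (O ∪ walkSupp (fun _ => Prod.mk) w').card +
        (if w' (Fin.castSucc (0 : Fin (s + 1))) = w t.castSucc ∧
              w' (Fin.succ (0 : Fin (s + 1))) = w t.succ then 1 else 0) *
          q ^ (O ∪ walkSupp (fun _ => Prod.mk) w').card) := by
          refine Finset.sum_le_sum fun w' _ => ?_
          have hnn : ∀ t : Fin (s + 1), 0 ≤
            ((if w' t.castSucc = w 0 ∧ w' t.succ = w 1 then 1 else 0) *
              q ^ (O ∪ walkSupp (fun _ => Prod.mk) w').card +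
            (if w' (Fin.castSucc (0 : Fin (s + 1))) = w t.castSucc ∧
              w' (Fin.succ (0 : Fin (s + 1))) = w t.succ then 1 else 0) *
              q ^ (O ∪ walkSupp (fun _ => Prod.mk) w').card) := fun t => by positivity
          split_ifs with hl
          · obtain ⟨t, ht⟩ := hl
            refine le_trans ?_ (Finset.single_le_sum (fun t _ => hnn t) (Finset.mem_univ t))
            rcases ht with ht | ht
            · rw [if_pos ht]
              exact le_add_of_nonneg_right (by positivity)
            · rw [if_pos (⟨ht.1.symm, ht.2.symm⟩ :
                w' (Fin.castSucc (0 : Fin (s + 1))) = w t.castSucc ∧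
              w' (Fin.succ (0 : Fin (s + 1))) = w t.succ)]
              exact le_add_of_nonneg_left (by positivity)
          · rw [zero_mul]
            exact Finset.sum_nonneg fun t _ => hnn t
      _ ≤ ∑ t : Fin (s + 1), (D₀ ^ s * q ^ O.card + D₀ ^ s * q ^ O.card) := by
          rw [Finset.sum_comm]
          refine Finset.sum_le_sum fun t _ => ?_
          rw [Finset.sum_add_distrib]
          exact add_le_add (hedge O hO t _ _) (hedge O hO 0 _ _)
      _ = _ := by
          rw [Finset.sum_const, Finset.card_univ, Fintype.card_fin, nsmul_eq_mul]
          ring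
  · intro O hO
    have h1 := sum_walk_le hq (fun _ => Prod.mk) (fun _ u => hedi u) O (N := N) hO
      (fun v => a v ^ 2) (fun v => sq_nonneg _)
    refine h1.trans ?_
    rw [← mul_assoc]
    refine mul_le_mul_of_nonneg_right ?_ (by positivity)
    calc _ ≤ D₀ ^ (s + 1) * 1 := mul_le_mul_of_nonneg_left ha2 (by positivity)
      _ ≤ _ := by
        rw [mul_one]
        exact le_mul_of_one_le_left (by positivity) (by norm_num)
  · intro O hO
    exact sum_returns_le hq O hO

/-! ### Moments of the noise -/

/-- Moments of a bounded centered random variable. -/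
lemma abs_integral_pow_le {Ω : Type*} [MeasurableSpace Ω] {P : Measure Ω} [IsProbabilityMeasure P]
    {h : Ω → ℝ} (hm : Measurable h) (h0 : ∫ ω, h ω ∂P = 0) {σ B : ℝ} (hB : 0 < B)
    (hv : variance h P ≤ σ ^ 2) (hb : ∀ᵐ ω ∂P, |h ω| ≤ B) (c : ℕ) :
    |∫ ω, h ω ^ c ∂P| ≤ B ^ c * (if c = 0 then 1 else if c = 1 then 0 else σ ^ 2 / B ^ 2) := by
  rcases c with _ | _ | c
  · simp
  · simp [h0]
  · rw [if_neg (by omega), if_neg (by omega)]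
    have hi : ∀ k : ℕ, Integrable (fun ω => h ω ^ k) P := fun k =>
      Integrable.of_bound (hm.pow_const k).aestronglyMeasurable (B ^ k) (by
        filter_upwards [hb] with ω hω
        rw [norm_pow, Real.norm_eq_abs]
        exact pow_le_pow_left₀ (abs_nonneg _) hω k)
    have hvar : ∫ ω, h ω ^ 2 ∂P ≤ σ ^ 2 := by
      rw [← variance_of_integral_eq_zero hm.aemeasurable h0]
      exact hv
    calc |∫ ω, h ω ^ (c + 2) ∂P| ≤ ∫ ω, |h ω ^ (c + 2)| ∂P := abs_integral_le_integral_abs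
      _ ≤ ∫ ω, B ^ c * h ω ^ 2 ∂P := by
        refine integral_mono_ae (hi _).abs ((hi 2).const_mul _) ?_
        filter_upwards [hb] with ω hω
        rw [abs_pow, pow_add, sq_abs]
        exact mul_le_mul_of_nonneg_right (pow_le_pow_left₀ (abs_nonneg _) hω c) (sq_nonneg _)
      _ ≤ B ^ c * σ ^ 2 := by
        rw [integral_const_mul]
        exact mul_le_mul_of_nonneg_left hvar (by positivity)
      _ = _ := by
        field_simp
        ring

open Classical in
/-- Mixed moments of independent bounded centered random variables. -/
lemma abs_integral_prod_le {Ω E κ : Type*} [MeasurableSpace Ω] {P : Measure Ω}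
    [IsProbabilityMeasure P] [Fintype E] [Fintype κ] [DecidableEq E] {h : E → Ω → ℝ}
    (hm : ∀ e, Measurable (h e)) (hind : iIndepFun h P) (h0 : ∀ e, ∫ ω, h e ω ∂P = 0)
    {σ B : ℝ} (hB : 0 < B) (hv : ∀ e, variance (h e) P ≤ σ ^ 2)
    (hb : ∀ e, ∀ᵐ ω ∂P, |h e ω| ≤ B) (f : κ → E) :
    |∫ ω, ∏ k, h (f k) ω ∂P| ≤ (if ∀ k, ∃ k', k' ≠ k ∧ f k' = f k then 1 else 0) *
      (B ^ Fintype.card κ * (σ ^ 2 / B ^ 2) ^ (Finset.univ.image f).card) := by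
  set c : E → ℕ := fun e => (Finset.univ.filter fun k => f k = e).card with hc
  have h1 : ∀ ω, ∏ k, h (f k) ω = ∏ e, h e ω ^ c e := by
    intro ω
    rw [← Finset.prod_fiberwise (s := Finset.univ) (g := f)]
    refine Finset.prod_congr rfl fun e _ => ?_
    rw [hc, ← Finset.prod_const]
    exact Finset.prod_congr rfl fun k hk => by rw [(Finset.mem_filter.1 hk).2]
  have h2 : ∫ ω, ∏ k, h (f k) ω ∂P = ∏ e, ∫ ω, h e ω ^ c e ∂P := by
    simp only [h1]
    exact (hind.comp (fun e x => x ^ c e)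
      fun e => measurable_id.pow_const _).integral_fun_prod_eq_prod_integral
      fun e => ((hm e).pow_const _).aestronglyMeasurable
  have h3 : ∑ e, c e = Fintype.card κ := by
    rw [hc, ← Finset.card_univ (α := κ)]
    exact (Finset.card_eq_sum_card_fiberwise fun _ _ => Finset.mem_coe.2 (Finset.mem_univ _)).symm
  have h4 : |∫ ω, ∏ k, h (f k) ω ∂P| ≤
      ∏ e, B ^ c e * (if c e = 0 then 1 else if c e = 1 then 0 else σ ^ 2 / B ^ 2) := by
    rw [h2, Finset.abs_prod]
    exact Finset.prod_le_prod (fun _ _ => abs_nonneg _) fun e _ =>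
      abs_integral_pow_le (hm e) (h0 e) hB (hv e) (hb e) (c e)
  refine h4.trans ?_
  rw [Finset.prod_mul_distrib, Finset.prod_pow_eq_pow_sum, h3]
  by_cases hg : ∀ k, ∃ k', k' ≠ k ∧ f k' = f k
  · rw [if_pos hg, one_mul]
    refine mul_le_mul_of_nonneg_left ?_ (by positivity)
    rw [← Finset.prod_const, ← Finset.prod_subset (Finset.subset_univ (Finset.univ.image f))]
    · refine Finset.prod_le_prod (fun _ _ => by positivity) fun e he => ?_
      obtain ⟨k, _, rfl⟩ := Finset.mem_image.1 he
      obtain ⟨k', hk', hfk⟩ := hg k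
      have : 1 < c (f k) := Finset.one_lt_card.2 ⟨k, by simp, k', by simp [hfk], hk'.symm⟩
      rw [if_neg (by omega), if_neg (by omega)]
    · intro e _ he
      rw [if_pos]
      rw [hc, Finset.card_eq_zero, Finset.filter_eq_empty_iff]
      intro k _ hk
      exact he (hk ▸ Finset.mem_image_of_mem f (Finset.mem_univ k))
  -- An entry used exactly once contributes its mean as a factor.
  · rw [if_neg hg, zero_mul]
    push Not at hg
    obtain ⟨k, hk⟩ := hg
    have hck : c (f k) = 1 := by
      rw [hc, Finset.card_eq_one]
      refine ⟨k, ?_⟩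
      ext k'
      simp only [Finset.mem_filter, Finset.mem_univ, true_and, Finset.mem_singleton]
      exact ⟨fun h => by_contra fun h' => hk k' h' h, fun h => h ▸ rfl⟩
    rw [Finset.prod_eq_zero (Finset.mem_univ (f k)) (by simp [hck]), mul_zero]

/-- The product `A 0 * A 1 * ⋯ * A (s - 1)`. -/
def stepProd {V R : Type*} [Fintype V] [DecidableEq V] [CommSemiring R] (A : ℕ → Matrix V V R) :
    ℕ → Matrix V V R
  | 0 => 1
  | s + 1 => stepProd A s * A s

lemma stepProd_const {V R : Type*} [Fintype V] [DecidableEq V] [CommSemiring R]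
    (A : Matrix V V R) (s : ℕ) : stepProd (fun _ => A) s = A ^ s := by
  induction s with
  | zero => simp [stepProd]
  | succ s ih => rw [stepProd, ih, pow_succ]

lemma stepProd_alternate {V R : Type*} [Fintype V] [DecidableEq V] [CommSemiring R]
    (A B : Matrix V V R) (k : ℕ) :
    stepProd (fun t => if Even t then A else B) (2 * k) = (A * B) ^ k := by
  induction k with
  | zero => simp [stepProd]
  | succ k ih =>
    rw [Nat.mul_succ, stepProd, stepProd, ih, pow_succ, if_pos (even_two_mul k),
      if_neg (by simp), mul_assoc]

lemma sum_stepProd {V R : Type*} [Fintype V] [DecidableEq V] [CommSemiring R]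
    (A : ℕ → Matrix V V R) (c : V → R) (s : ℕ) (b : V → R) :
    ∑ i, ∑ k, c i * stepProd A s i k * b k =
      ∑ w : Fin (s + 1) → V, c (w 0) * b (w (Fin.last s)) *
        ∏ t : Fin s, A t (w t.castSucc) (w t.succ) := by
  induction s generalizing b with
  | zero =>
    rw [← (Equiv.funUnique (Fin 1) V).symm.sum_comp]
    simp [stepProd, Matrix.one_apply]
  | succ s ih =>
    rw [sum_snoc]
    have h1 : ∀ i, ∑ k, c i * stepProd A (s + 1) i k * b k =
        ∑ j, c i * stepProd A s i j * ∑ k, A s j k * b k := by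
      intro i
      simp only [stepProd, Matrix.mul_apply, Finset.mul_sum, Finset.sum_mul]
      rw [Finset.sum_comm]
      exact Finset.sum_congr rfl fun j _ => Finset.sum_congr rfl fun k _ => by ring
    simp only [h1]
    rw [ih fun j => ∑ k, A s j k * b k]
    refine Finset.sum_congr rfl fun w _ => ?_
    rw [Finset.mul_sum, Finset.sum_mul]
    refine Finset.sum_congr rfl fun v _ => ?_
    rw [Fin.prod_univ_castSucc]
    have h0 : (Fin.snoc w v : Fin (s + 2) → V) 0 = w 0 := rfl
    simp only [Fin.snoc_castSucc, Fin.succ_castSucc, Fin.succ_last, Fin.snoc_last,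
      Fin.val_castSucc, Fin.val_last, h0]
    ring

lemma integrable_prod_of_bounded {Ω E κ : Type*} [MeasurableSpace Ω] {P : Measure Ω}
    [IsProbabilityMeasure P] [Fintype κ] {h : E → Ω → ℝ} (hm : ∀ e, Measurable (h e)) {B : ℝ}
    (hb : ∀ e, ∀ᵐ ω ∂P, |h e ω| ≤ B) (f : κ → E) :
    Integrable (fun ω => ∏ k, h (f k) ω) P := by
  refine Integrable.of_bound
    (Finset.measurable_fun_prod _ fun k _ => hm (f k)).aestronglyMeasurable
    (B ^ Fintype.card κ) ?_
  filter_upwards [ae_all_iff.2 fun k => hb (f k)] with ω hω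
  rw [Real.norm_eq_abs, Finset.abs_prod, ← Finset.card_univ, ← Finset.prod_const]
  exact Finset.prod_le_prod (fun _ _ => abs_nonneg _) fun k _ => hω k

lemma pow_mul_pow_mul_mul_pow (β B S D : ℝ) (s m : ℕ) :
    β ^ m * B ^ (m * (s + 1)) * (6 * S * D ^ (s + 1)) ^ m =
      (β * (6 * S * (B * D) ^ (s + 1))) ^ m := by
  rw [mul_comm m, pow_mul, ← mul_pow, ← mul_pow, mul_pow B]
  congr 1
  ring

/-- Moments of bilinear forms of powers of the noise matrix. -/
lemma integral_bilin_pow_le {Ω V : Type*} [MeasurableSpace Ω] {P : Measure Ω}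
    [IsProbabilityMeasure P] [Fintype V] [DecidableEq V] {H : Ω → Matrix V V ℝ}
    (hm : ∀ i j, Measurable fun ω => H ω i j)
    (hind : iIndepFun (fun (p : V × V) ω => H ω p.1 p.2) P)
    (h0 : ∀ i j, ∫ ω, H ω i j ∂P = 0) {σ B : ℝ} (hB : 0 < B)
    (hv : ∀ i j, variance (fun ω => H ω i j) P ≤ σ ^ 2)
    (hb : ∀ i j, ∀ᵐ ω ∂P, |H ω i j| ≤ B) (hq : σ ^ 2 / B ^ 2 ≤ 1)
    {a b : V → ℝ} {β : ℝ} (ha : ∑ i, a i ^ 2 ≤ 1) (hβ : 0 ≤ β) (hbβ : ∀ i, |b i| ≤ β) (s m : ℕ) :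
    Integrable (fun ω => (∑ i, ∑ k, a i * (H ω ^ (s + 1)) i k * b k) ^ m) P ∧
    ∫ ω, (∑ i, ∑ k, a i * (H ω ^ (s + 1)) i k * b k) ^ m ∂P ≤
      (β * (6 * (s + 1 : ℕ) * (B * (Fintype.card V * (σ ^ 2 / B ^ 2) + (m * (s + 1) : ℕ))) ^ (s + 1)))
        ^ m := by
  classical
  set q := σ ^ 2 / B ^ 2 with hqd
  have hq0 : 0 ≤ q := by positivity
  set h : V × V → Ω → ℝ := fun p ω => H ω p.1 p.2 with hh
  let f : (Fin m → (Fin (s + 2) → V)) → Fin m × Fin (s + 1) → V × V :=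
    fun v k => (v k.1 k.2.castSucc, v k.1 k.2.succ)
  have hexp : ∀ ω, (∑ i, ∑ k, a i * (H ω ^ (s + 1)) i k * b k) ^ m =
      ∑ v : Fin m → (Fin (s + 2) → V),
        (∏ p, a (v p 0) * b (v p (Fin.last (s + 1)))) * ∏ k, h (f v k) ω := by
    intro ω
    rw [← stepProd_const, sum_stepProd, Fintype.sum_pow]
    refine Finset.sum_congr rfl fun v _ => ?_
    rw [Finset.prod_mul_distrib, Fintype.prod_prod_type]
  have hint : ∀ v, Integrable (fun ω => (∏ p, a (v p 0) * b (v p (Fin.last (s + 1)))) *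
      ∏ k, h (f v k) ω) P := fun v =>
    (integrable_prod_of_bounded (fun e => hm e.1 e.2) (fun e => hb e.1 e.2) (f v)).const_mul _
  simp only [hexp]
  refine ⟨integrable_finsetSum _ fun v _ => hint v, ?_⟩
  rw [integral_finsetSum _ fun v _ => hint v]
  have ha1 : ∀ i, |a i| ≤ 1 := fun i => by
    rw [← sq_le_one_iff_abs_le_one]
    exact (Finset.single_le_sum (f := fun i => a i ^ 2) (fun i _ => sq_nonneg _)
      (Finset.mem_univ i)).trans ha
  calc _ ≤ ∑ v : Fin m → (Fin (s + 2) → V), β ^ m * B ^ (m * (s + 1)) *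
      ((if AllLinked Returns Linked ∅ v then 1 else 0) *
        tupleWeight q (walkSupp fun _ => Prod.mk) (fun w => |a (w 0)|) ∅ v) := by
        refine Finset.sum_le_sum fun v _ => ?_
        rw [integral_const_mul]
        refine (le_abs_self _).trans ?_
        rw [abs_mul, Finset.abs_prod]
        have h1 : ∏ p, |a (v p 0) * b (v p (Fin.last (s + 1)))| ≤ β ^ m * ∏ p, |a (v p 0)| := by
          have : β ^ m = ∏ p : Fin m, β := by simp
          rw [this, ← Finset.prod_mul_distrib]
          refine Finset.prod_le_prod (fun _ _ => abs_nonneg _) fun p _ => ?_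
          rw [abs_mul, mul_comm]
          exact mul_le_mul_of_nonneg_right (hbβ _) (abs_nonneg _)
        have h2 := abs_integral_prod_le (fun e : V × V => hm e.1 e.2) hind
          (fun e => h0 e.1 e.2) hB (fun e => hv e.1 e.2) (fun e => hb e.1 e.2) (f v)
        have h3 : Finset.univ.image (f v) =
            ∅ ∪ Finset.univ.biUnion fun i => walkSupp (fun _ => Prod.mk) (v i) := by
          ext e
          simp [f, walkSupp]
        -- Of all repetitions only those of first edges are kept: a repetition within the same walk
        -- is a second step from its starting point, and one in another walk is a link.
        have h4 : (∀ k, ∃ k', k' ≠ k ∧ f v k' = f v k) → AllLinked Returns Linked ∅ v := by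
          intro hg p
          obtain ⟨⟨p', t⟩, hne, he⟩ := hg (p, 0)
          simp only [f, Prod.mk.injEq] at he
          by_cases hp : p' = p
          · subst hp
            left
            refine ⟨t, ?_, he.1⟩
            rw [Nat.pos_iff_ne_zero]
            intro ht
            exact hne (Prod.ext rfl (Fin.ext ht))
          · exact Or.inr (Or.inr ⟨p', hp, t, Or.inr ⟨he.1, he.2⟩⟩)
        rw [h3, Fintype.card_prod, Fintype.card_fin, Fintype.card_fin] at h2
        have h6 := mul_nonneg (pow_nonneg hB.le (m * (s + 1))) (pow_nonneg hq0
          (∅ ∪ Finset.univ.biUnion fun i => walkSupp (fun _ => Prod.mk) (v i)).card)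
        have h7 : |∫ ω, ∏ k, h (f v k) ω ∂P| ≤ (if AllLinked Returns Linked ∅ v then 1 else 0) *
            (B ^ (m * (s + 1)) * q ^ (∅ ∪ Finset.univ.biUnion fun i =>
              walkSupp (fun _ => Prod.mk) (v i)).card) := by
          refine h2.trans (mul_le_mul_of_nonneg_right ?_ h6)
          split_ifs with h8 h9 h9
          · exact le_rfl
          · exact absurd (h4 h8) h9
          · exact zero_le_one
          · exact le_rfl
        refine (mul_le_mul h1 h7
          (abs_nonneg _) (mul_nonneg (pow_nonneg hβ _)
            (Finset.prod_nonneg fun _ _ => abs_nonneg _))).trans (le_of_eq ?_)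
        unfold tupleWeight
        ring
    _ ≤ _ := by
        rw [← Finset.mul_sum]
        have h1 := sum_allLinked_walk_le hq0 hq (a := fun i => |a i|) (fun i => abs_nonneg _) ha1
          (by simpa only [sq_abs] using ha) s m
        have hc : 0 ≤ β ^ m * B ^ (m * (s + 1)) := mul_nonneg (pow_nonneg hβ _) (pow_nonneg hB.le _)
        rw [← pow_mul_pow_mul_mul_pow β B _ _ s m]
        exact mul_le_mul_of_nonneg_left h1 hc

/-- Moments of the Schatten norms of the noise matrix. -/
lemma integral_trace_le {Ω V : Type*} [MeasurableSpace Ω] {P : Measure Ω}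
    [IsProbabilityMeasure P] [Fintype V] [DecidableEq V] {H : Ω → Matrix V V ℝ}
    (hm : ∀ i j, Measurable fun ω => H ω i j)
    (hind : iIndepFun (fun (p : V × V) ω => H ω p.1 p.2) P)
    (h0 : ∀ i j, ∫ ω, H ω i j ∂P = 0) {σ B : ℝ} (hB : 0 < B)
    (hv : ∀ i j, variance (fun ω => H ω i j) P ≤ σ ^ 2)
    (hb : ∀ i j, ∀ᵐ ω ∂P, |H ω i j| ≤ B) (k : ℕ) :
    Integrable (fun ω => ((H ω * (H ω).transpose) ^ k).trace) P ∧
    ∫ ω, ((H ω * (H ω).transpose) ^ k).trace ∂P ≤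
      Fintype.card V * (B * (Fintype.card V * (σ ^ 2 / B ^ 2) + (2 * k : ℕ))) ^ (2 * k) := by
  classical
  set q := σ ^ 2 / B ^ 2 with hqd
  have hq0 : 0 ≤ q := by positivity
  set h : V × V → Ω → ℝ := fun p ω => H ω p.1 p.2 with hh
  -- Factors `H` and `Hᵀ` alternate, so odd steps traverse their edge backwards.
  let ed : ℕ → V → V → V × V := fun t u v => if Even t then (u, v) else (v, u)
  have hed : ∀ t u, Function.Injective (ed t u) := by
    intro t u v v' hvv
    by_cases ht : Even t <;> simpa [ed, ht] using hvv
  let f : (Fin (2 * k + 1) → V) → Fin (2 * k) → V × V :=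
    fun w t => ed t (w t.castSucc) (w t.succ)
  let c : V → (Fin (2 * k + 1) → V) → ℝ := fun u w =>
    (if w 0 = u then 1 else 0) * (if w (Fin.last (2 * k)) = u then 1 else 0)
  have hexp : ∀ ω, ((H ω * (H ω).transpose) ^ k).trace =
      ∑ u, ∑ w : Fin (2 * k + 1) → V, c u w * ∏ t, h (f w t) ω := by
    intro ω
    rw [← stepProd_alternate, Matrix.trace]
    refine Finset.sum_congr rfl fun u _ => ?_
    have := sum_stepProd (fun t => if Even t then H ω else (H ω).transpose)
      (fun i => if i = u then 1 else 0) (2 * k) (fun i => if i = u then 1 else 0)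
    simp only [ite_mul, one_mul, zero_mul, mul_ite, mul_one, mul_zero, Finset.sum_ite_eq',
      Finset.mem_univ, if_true] at this
    rw [Matrix.diag_apply, this]
    refine Finset.sum_congr rfl fun w _ => ?_
    have hp : ∏ t : Fin (2 * k), (if Even (t : ℕ) then H ω else (H ω).transpose)
        (w t.castSucc) (w t.succ) = ∏ t, h (f w t) ω := by
      refine Finset.prod_congr rfl fun t _ => ?_
      by_cases ht : Even (t : ℕ) <;> simp [hh, f, ed, ht]
    rw [hp]
    simp only [c]
    split_ifs <;> simp
  have hint : ∀ u w, Integrable (fun ω => c u w * ∏ t, h (f w t) ω) P := fun u w =>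
    (integrable_prod_of_bounded (fun e => hm e.1 e.2) (fun e => hb e.1 e.2) (f w)).const_mul _
  simp only [hexp]
  refine ⟨integrable_finsetSum _ fun u _ => integrable_finsetSum _ fun w _ => hint u w, ?_⟩
  rw [integral_finsetSum _ fun u _ => integrable_finsetSum _ fun w _ => hint u w]
  have hu : ∀ u, ∫ ω, ∑ w : Fin (2 * k + 1) → V, c u w * ∏ t, h (f w t) ω ∂P ≤
      (B * (Fintype.card V * q + (2 * k : ℕ))) ^ (2 * k) := by
    intro u
    rw [integral_finsetSum _ fun w _ => hint u w]
    have h1 := sum_walk_le hq0 ed hed (s := 2 * k) (N := 2 * k) ∅ (by simp)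
      (fun v => if v = u then 1 else 0) (fun v => by positivity)
    rw [Finset.sum_ite_eq' Finset.univ u, if_pos (Finset.mem_univ u), Finset.card_empty,
      pow_zero, one_mul, mul_one] at h1
    rw [mul_pow]
    refine le_trans ?_ (mul_le_mul_of_nonneg_left h1 (pow_nonneg hB.le _))
    rw [Finset.mul_sum]
    refine Finset.sum_le_sum fun w _ => ?_
    rw [integral_const_mul]
    refine (le_abs_self _).trans ?_
    rw [abs_mul]
    have h2 := abs_integral_prod_le (fun e : V × V => hm e.1 e.2) hind
      (fun e => h0 e.1 e.2) hB (fun e => hv e.1 e.2) (fun e => hb e.1 e.2) (f w)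
    have h3 : Finset.univ.image (f w) = ∅ ∪ walkSupp ed w := (Finset.empty_union _).symm
    rw [h3, Fintype.card_fin] at h2
    -- The condition that the walk closes up is dropped.
    have h4 : |c u w| ≤ if w 0 = u then 1 else 0 := by
      simp only [c]
      split_ifs <;> simp
    -- The requirement that edges repeat is dropped as well: here the starting point is fixed, and
    -- the exploration cost alone suffices.
    have h5 : |∫ ω, ∏ t, h (f w t) ω ∂P| ≤ B ^ (2 * k) * q ^ (∅ ∪ walkSupp ed w).card :=
      h2.trans (mul_le_of_le_one_left (by positivity) (by split_ifs <;> simp))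
    refine (mul_le_mul h4 h5 (abs_nonneg _) (by positivity)).trans (le_of_eq (by ring))
  refine (Finset.sum_le_sum fun u _ => hu u).trans (le_of_eq ?_)
  rw [Finset.sum_const, nsmul_eq_mul, Finset.card_univ]

/-! ### Tail bounds for the noise -/

lemma one_le_log_of_three_le {n : ℕ} (hn : 3 ≤ n) : 1 ≤ Real.log n := by
  rw [Real.le_log_iff_exp_le (by positivity)]
  have : (3 : ℝ) ≤ n := by exact_mod_cast hn
  linarith [Real.exp_one_lt_d9]

lemma inv_three_pow_le {n N k : ℕ} (hn : 3 ≤ n) (hN : k * ⌈Real.log n⌉₊ ≤ N) :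
    (1 / 3 : ℝ) ^ N ≤ 1 / (n : ℝ) ^ k := by
  have hn0 : (0 : ℝ) < n := by positivity
  have h1 : (n : ℝ) ≤ 3 ^ ⌈Real.log n⌉₊ := by
    calc (n : ℝ) = Real.exp (Real.log n) := (Real.exp_log hn0).symm
      _ ≤ Real.exp ⌈Real.log n⌉₊ := Real.exp_le_exp.2 (Nat.le_ceil _)
      _ = Real.exp 1 ^ ⌈Real.log n⌉₊ := by rw [← Real.exp_nat_mul, mul_one]
      _ ≤ _ := pow_le_pow_left₀ (Real.exp_pos _).le (by linarith [Real.exp_one_lt_d9]) _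
  rw [one_div_pow]
  refine one_div_le_one_div_of_le (by positivity) ?_
  calc (n : ℝ) ^ k ≤ (3 ^ ⌈Real.log n⌉₊) ^ k := pow_le_pow_left₀ hn0.le h1 k
    _ = 3 ^ (k * ⌈Real.log n⌉₊) := by rw [← pow_mul, mul_comm]
    _ ≤ _ := pow_le_pow_right₀ (by norm_num) hN

/-- The bound on the entries may be enlarged to `noiseLevel / log n`, which makes the noise at most
as dense as a random digraph with average degree `log n`. -/
lemma noiseLevel_scale {n : ℕ} (hn : 3 ≤ n) {σ B : ℝ} (hσ : 0 ≤ σ)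
    (hL : 0 < noiseLevel n σ B) :
    0 < noiseLevel n σ B / Real.log n ∧ B ≤ noiseLevel n σ B / Real.log n ∧
    σ ^ 2 / (noiseLevel n σ B / Real.log n) ^ 2 ≤ 1 ∧
    ∀ N : ℕ, N ≤ 24 * ⌈Real.log n⌉₊ → noiseLevel n σ B / Real.log n *
      (n * (σ ^ 2 / (noiseLevel n σ B / Real.log n) ^ 2) + N) ≤ 50 * noiseLevel n σ B := by
  have hlog := one_le_log_of_three_le hn
  have hlog0 : 0 < Real.log n := by linarith
  set L := noiseLevel n σ B with hLd
  have hn0 : (0 : ℝ) < n := by positivity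
  have h1 : σ * √(n * Real.log n) ≤ L := le_max_left _ _
  have h2 : B * Real.log n ≤ L := le_max_right _ _
  have h3 : σ ^ 2 * (n * Real.log n) ≤ L ^ 2 := by
    have := pow_le_pow_left₀ (by positivity) h1 2
    rwa [mul_pow, Real.sq_sqrt (by positivity)] at this
  have hq : n * (σ ^ 2 / (L / Real.log n) ^ 2) ≤ Real.log n := by
    rw [div_pow, ← mul_div_assoc, div_le_iff₀ (by positivity)]
    have : Real.log n * (L ^ 2 / Real.log n ^ 2) = L ^ 2 / Real.log n := by field_simp
    rw [this, le_div_iff₀ hlog0]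
    linarith
  refine ⟨by positivity, (le_div_iff₀ hlog0).2 h2, ?_, ?_⟩
  · have h4 : Real.log n ≤ n := (Real.log_le_sub_one_of_pos hn0).trans (by linarith)
    have h5 := hq.trans h4
    exact le_of_mul_le_mul_left (by linarith) hn0
  · intro N hN
    have h6 : (N : ℝ) ≤ 24 * ⌈Real.log n⌉₊ := by exact_mod_cast hN
    have h7 := (Nat.ceil_lt_add_one hlog0.le).le
    have h8 : n * (σ ^ 2 / (L / Real.log n) ^ 2) + N ≤ 50 * Real.log n := by linarith
    calc _ ≤ L / Real.log n * (50 * Real.log n) := by gcongr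
      _ = _ := by field_simp

lemma measureReal_le_of_integral_le {Ω : Type*} [MeasurableSpace Ω] {P : Measure Ω}
    {X : Ω → ℝ} (hX : Integrable X P) (h0 : ∀ ω, 0 ≤ X ω) {t p : ℝ} (ht : 0 < t)
    (h : ∫ ω, X ω ∂P ≤ t * p) : P.real {ω | t ≤ X ω} ≤ p := by
  have := mul_meas_ge_le_integral_of_nonneg (Filter.Eventually.of_forall h0) hX t
  exact le_of_mul_le_mul_left (this.trans h) ht

/-- Tail bound for bilinear forms of powers of the noise matrix. -/
lemma measureReal_bilin_le {n : ℕ} (hn : 3 ≤ n) {Ω : Type*} [MeasurableSpace Ω] {P : Measure Ω}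
    [IsProbabilityMeasure P] {H : Ω → Matrix (Fin n) (Fin n) ℝ} {σ B : ℝ} (hσ : 0 ≤ σ)
    (hH : IsNoise P H σ B) (hL : 0 < noiseLevel n σ B) {a b : Fin n → ℝ} {β : ℝ}
    (ha : ∑ i, a i ^ 2 ≤ 1) (hβ : 0 < β) (hb : ∀ i, |b i| ≤ β) {s : ℕ}
    (hs : s + 1 ≤ ⌈Real.log n⌉₊) :
    P.real {ω | β * (1800 * noiseLevel n σ B) ^ (s + 1) ≤
      |∑ i, ∑ k, a i * (H ω ^ (s + 1)) i k * b k|} ≤ 1 / (n : ℝ) ^ 12 := by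
  obtain ⟨hB0, hB, hq, hD⟩ := noiseLevel_scale hn hσ hL
  set ℓ := ⌈Real.log n⌉₊ with hℓ
  set L := noiseLevel n σ B with hLd
  -- The total length m (s + 1) lies between 12ℓ and 24ℓ: long enough that 3^{-m(s+1)} ≤ n^{-12},
  -- and short enough for `noiseLevel_scale`. The factor 12 also makes m even.
  set m := 12 * (ℓ / (s + 1) + 1) with hm
  have hdm := Nat.div_add_mod ℓ (s + 1)
  have hml : ℓ % (s + 1) < s + 1 := Nat.mod_lt ℓ (Nat.succ_pos s)
  have hms : m * (s + 1) = 12 * ((s + 1) * (ℓ / (s + 1)) + (s + 1)) := by rw [hm]; ring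
  have hN1 : 12 * ℓ ≤ m * (s + 1) := by omega
  have hN2 : m * (s + 1) ≤ 24 * ℓ := by omega
  obtain ⟨hint, hmom⟩ := integral_bilin_pow_le hH.measurable hH.indep hH.mean_zero hB0
    hH.variance_le (fun i j => (hH.bounded i j).mono fun ω hω => hω.trans hB) hq ha hβ.le hb s m
  rw [Fintype.card_fin] at hmom
  have hme : Even m := by rw [hm, mul_comm]; exact Even.mul_left (by decide) _
  -- The polynomial factor is absorbed into the base. The threshold 1800 is 3 · 12 · 50, where the 3
  -- is the gain in Markov's inequality.
  have h1 : (6 * (s + 1 : ℕ) : ℝ) ≤ 12 ^ (s + 1) := by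
    have h2 : (s + 1 : ℕ) ≤ 2 ^ (s + 1) := (Nat.lt_two_pow_self).le
    have h3 : 6 * (s + 1) ≤ 6 ^ (s + 1) * 2 ^ (s + 1) :=
      Nat.mul_le_mul (Nat.le_self_pow (by omega) 6) h2
    rw [← mul_pow] at h3
    exact_mod_cast h3
  have hD0 : 0 ≤ L / Real.log n *
      (n * (σ ^ 2 / (L / Real.log n) ^ 2) + (m * (s + 1) : ℕ)) := by positivity
  have h4 : β * (6 * (s + 1 : ℕ) * (L / Real.log n *
      (n * (σ ^ 2 / (L / Real.log n) ^ 2) + (m * (s + 1) : ℕ))) ^ (s + 1)) ≤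
      β * (1800 * L) ^ (s + 1) * (1 / 3) ^ (s + 1) := by
    rw [mul_assoc β ((1800 * L) ^ (s + 1)), ← mul_pow]
    refine mul_le_mul_of_nonneg_left ?_ hβ.le
    calc _ ≤ (12 : ℝ) ^ (s + 1) * (50 * L) ^ (s + 1) :=
          mul_le_mul h1 (pow_le_pow_left₀ hD0 (hD _ hN2) _) (pow_nonneg hD0 _) (by positivity)
      _ = _ := by rw [← mul_pow]; congr 1; ring
  have h5 : ∫ ω, (∑ i, ∑ k, a i * (H ω ^ (s + 1)) i k * b k) ^ m ∂P ≤
      (β * (1800 * L) ^ (s + 1)) ^ m * (1 / (n : ℝ) ^ 12) := by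
    refine hmom.trans ((pow_le_pow_left₀ ?_ h4 m).trans ?_)
    · exact mul_nonneg hβ.le (mul_nonneg (by positivity) (pow_nonneg hD0 _))
    · rw [mul_pow _ (_ ^ (s + 1)) m, ← pow_mul, mul_comm (s + 1)]
      exact mul_le_mul_of_nonneg_left (inv_three_pow_le hn hN1) (by positivity)
  refine le_trans (measureReal_mono ?_) (measureReal_le_of_integral_le hint
    (fun ω => hme.pow_nonneg _) (by positivity) h5)
  intro ω hω
  rw [Set.mem_ofPred_eq] at hω ⊢
  rw [← hme.pow_abs (∑ i, ∑ k, a i * (H ω ^ (s + 1)) i k * b k)]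
  exact pow_le_pow_left₀ (by positivity) hω m

lemma trace_pow_two_mul {V : Type*} [Fintype V] [DecidableEq V] {S : Matrix V V ℝ}
    (hS : S.IsSymm) (k : ℕ) : (S ^ (2 * k)).trace = ∑ i, ∑ j, (S ^ k) i j ^ 2 := by
  have h : (S ^ k).transpose = S ^ k := by rw [Matrix.transpose_pow, hS.eq]
  rw [mul_comm, pow_mul, pow_two, Matrix.trace]
  refine Finset.sum_congr rfl fun i _ => ?_
  rw [Matrix.diag_apply, Matrix.mul_apply]
  refine Finset.sum_congr rfl fun j _ => ?_
  nth_rewrite 2 [← h]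
  rw [Matrix.transpose_apply, pow_two]

open scoped Matrix.Norms.L2Operator in
lemma sq_l2_opNorm_le_sum {V : Type*} [Fintype V] [DecidableEq V] (A : Matrix V V ℂ) :
    ‖A‖ ^ 2 ≤ ∑ i, ∑ j, ‖A i j‖ ^ 2 := by
  have h0 : 0 ≤ ∑ i, ∑ j, ‖A i j‖ ^ 2 := Finset.sum_nonneg fun i _ =>
    Finset.sum_nonneg fun j _ => sq_nonneg _
  rw [← Real.sq_sqrt h0]
  refine pow_le_pow_left₀ (norm_nonneg _) ?_ 2
  rw [Matrix.cstar_norm_def]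
  refine ContinuousLinearMap.opNorm_le_bound _ (Real.sqrt_nonneg _) fun x => ?_
  rw [← Real.sqrt_sq (norm_nonneg x), ← Real.sqrt_mul h0, EuclideanSpace.norm_eq]
  refine Real.sqrt_le_sqrt ?_
  rw [Finset.sum_mul]
  refine Finset.sum_le_sum fun i _ => ?_
  rw [EuclideanSpace.norm_sq_eq, Matrix.ofLp_toEuclideanCLM, Matrix.mulVec, dotProduct]
  calc _ ≤ (∑ j, ‖A i j‖ * ‖x j‖) ^ 2 := by
        refine pow_le_pow_left₀ (norm_nonneg _) ((norm_sum_le _ _).trans (le_of_eq ?_)) 2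
        exact Finset.sum_congr rfl fun j _ => norm_mul _ _
    _ ≤ _ := Finset.sum_mul_sq_le_sq_mul_sq _ _ _

open scoped Matrix.Norms.L2Operator in
-- The trace is the squared Frobenius norm of (H Hᵀ)^(2^i), hence at least its squared operator
-- norm, which for this self-adjoint matrix is ‖H‖ to the power 2 · (2 · 2^i). Exponents are powers
-- of two so that the C*-identity can be iterated.
lemma l2_opNorm_le_of_trace_le {n : ℕ} {H : Matrix (Fin n) (Fin n) ℝ} {c : ℝ} (hc : 0 ≤ c) (i : ℕ)
    (h : ((H * H.transpose) ^ (2 * 2 ^ i)).trace ≤ c ^ (2 * (2 * 2 ^ i))) :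
    ‖H.map Complex.ofReal‖ ≤ c := by
  set Hc := H.map Complex.ofReal with hHc
  set S := H * H.transpose with hS
  have hSc : Hc * Hc.conjTranspose = S.map Complex.ofReal := by
    refine Eq.trans ?_ (Matrix.map_mul (f := Complex.ofRealHom) (L := H) (M := H.transpose)).symm
    refine congrArg (Hc * ·) ?_
    ext i j
    simp [hHc]
  have hpow : (Hc * Hc.conjTranspose) ^ 2 ^ i = (S ^ 2 ^ i).map Complex.ofReal := by
    rw [hSc]
    exact (map_pow (Complex.ofRealHom.mapMatrix (m := Fin n)) S _).symm
  have hsa : IsSelfAdjoint (Hc * Hc.conjTranspose) := IsSelfAdjoint.mul_star_self Hc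
  have h1 : ‖Hc‖ ^ (2 * (2 * 2 ^ i)) = ‖(Hc * Hc.conjTranspose) ^ 2 ^ i‖ ^ 2 := by
    rw [hsa.norm_pow_two_pow, ← Matrix.star_eq_conjTranspose, CStarRing.norm_self_mul_star]
    ring
  have h2 : ‖(Hc * Hc.conjTranspose) ^ 2 ^ i‖ ^ 2 ≤ c ^ (2 * (2 * 2 ^ i)) := by
    refine (sq_l2_opNorm_le_sum _).trans (le_trans (le_of_eq ?_) h)
    rw [trace_pow_two_mul (by rw [hS]; exact Matrix.isSymm_mul_transpose_self H), hpow]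
    simp
  rw [← h1] at h2
  exact le_of_pow_le_pow_left₀ (by positivity) hc h2

open scoped Matrix.Norms.L2Operator in
/-- Tail bound for the spectral norm of the noise matrix. -/
lemma measureReal_opNorm_le {n : ℕ} (hn : 3 ≤ n) {Ω : Type*} [MeasurableSpace Ω] {P : Measure Ω}
    [IsProbabilityMeasure P] {H : Ω → Matrix (Fin n) (Fin n) ℝ} {σ B : ℝ} (hσ : 0 ≤ σ)
    (hH : IsNoise P H σ B) (hL : 0 < noiseLevel n σ B) :
    P.real {ω | 150 * noiseLevel n σ B < ‖(H ω).map Complex.ofReal‖} ≤ 1 / (n : ℝ) ^ 11 := by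
  obtain ⟨hB0, hB, hq, hD⟩ := noiseLevel_scale hn hσ hL
  set ℓ := ⌈Real.log n⌉₊ with hℓ
  set L := noiseLevel n σ B with hLd
  have hℓ1 : 1 ≤ ℓ := Nat.one_le_iff_ne_zero.2 (Nat.ceil_pos.2 (by
    linarith [one_le_log_of_three_le hn])).ne'
  have hc1 := Nat.le_pow_clog (b := 2) (by norm_num) (12 * ℓ)
  have hc2 := Nat.pow_pred_clog_lt_self (b := 2) (by norm_num) (x := 12 * ℓ) (by omega)
  -- The power of two 2^(i+2) is the least one that is at least 12ℓ, hence below 24ℓ.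
  obtain ⟨i, hi⟩ : ∃ i, Nat.clog 2 (12 * ℓ) = i + 2 := by
    refine ⟨Nat.clog 2 (12 * ℓ) - 2, (Nat.sub_add_cancel ?_).symm⟩
    by_contra hlt
    have : 2 ^ Nat.clog 2 (12 * ℓ) ≤ 2 ^ 1 := Nat.pow_le_pow_right (by norm_num) (by omega)
    omega
  rw [hi] at hc1 hc2
  have hk : 2 * (2 * 2 ^ i) = 2 ^ (i + 2) := by ring
  have hN1 : 12 * ℓ ≤ 2 * (2 * 2 ^ i) := by rw [hk]; exact hc1
  have hN2 : 2 * (2 * 2 ^ i) ≤ 24 * ℓ := by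
    have : 2 ^ (i + 2).pred = 2 * 2 ^ i := by rw [Nat.pred_succ]; ring
    omega
  obtain ⟨hint, hmom⟩ := integral_trace_le hH.measurable hH.indep hH.mean_zero hB0
    hH.variance_le (fun i j => (hH.bounded i j).mono fun ω hω => hω.trans hB) (2 * 2 ^ i)
  rw [Fintype.card_fin] at hmom
  set N := 2 * (2 * 2 ^ i) with hN
  have hn0 : (0 : ℝ) < n := by positivity
  have h5 : ∫ ω, ((H ω * (H ω).transpose) ^ (2 * 2 ^ i)).trace ∂P ≤
      (150 * L) ^ N * (1 / (n : ℝ) ^ 11) := by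
    refine hmom.trans ?_
    have hD0 : 0 ≤ L / Real.log n *
      (n * (σ ^ 2 / (L / Real.log n) ^ 2) + (N : ℕ)) := by positivity
    calc _ ≤ (n : ℝ) * (50 * L) ^ N :=
          mul_le_mul_of_nonneg_left (pow_le_pow_left₀ hD0 (hD _ hN2) _) hn0.le
      _ = n * (150 * L) ^ N * (1 / 3) ^ N := by
          rw [mul_assoc, ← mul_pow]; congr 2; ring
      _ ≤ n * (150 * L) ^ N * (1 / (n : ℝ) ^ 12) :=
          mul_le_mul_of_nonneg_left (inv_three_pow_le hn hN1) (by positivity)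
      _ = _ := by field_simp
  refine le_trans (measureReal_mono ?_) (measureReal_le_of_integral_le hint
    (fun ω => ?_) (by positivity) h5)
  · intro ω hω
    rw [Set.mem_ofPred_eq] at hω ⊢
    by_contra hlt
    exact absurd (l2_opNorm_le_of_trace_le (by positivity) i (not_le.1 hlt).le) (not_le.2 hω)
  · rw [trace_pow_two_mul (Matrix.isSymm_mul_transpose_self _)]
    exact Finset.sum_nonneg fun i _ => Finset.sum_nonneg fun j _ => sq_nonneg _

/-! ### Lower bound for the leading eigenvalues -/

lemma tendsto_zero_of_le_mul_add {a b : ℕ → ℝ} {θ : ℝ} (ha : ∀ k, 0 ≤ a k) (hθ0 : 0 ≤ θ)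
    (hθ : θ < 1) (h : ∀ k, a (k + 1) ≤ θ * a k + b k)
    (hb : Filter.Tendsto b Filter.atTop (nhds 0)) :
    Filter.Tendsto a Filter.atTop (nhds 0) := by
  rw [Metric.tendsto_atTop] at hb ⊢
  intro ε hε
  have h1θ : 0 < 1 - θ := by linarith
  obtain ⟨K, hK⟩ := hb (ε / 2 * (1 - θ)) (by positivity)
  have h1 : ∀ j, a (K + j) ≤ θ ^ j * a K + ε / 2 := by
    intro j
    induction j with
    | zero => simp; linarith
    | succ j ih =>
      have h2 := h (K + j)
      have h3 := (le_abs_self _).trans_lt (by simpa [Real.dist_eq] using hK (K + j) (by omega))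
      rw [← add_assoc, pow_succ']
      nlinarith
  have h4 : Filter.Tendsto (fun j => θ ^ j * a K) Filter.atTop (nhds 0) := by
    simpa using (tendsto_pow_atTop_nhds_zero_of_lt_one hθ0 hθ).mul_const (a K)
  obtain ⟨J, hJ⟩ := (Metric.tendsto_atTop.1 h4) (ε / 2) (by positivity)
  refine ⟨K + J, fun k hk => ?_⟩
  obtain ⟨j, rfl⟩ := Nat.exists_eq_add_of_le hk
  have h5 := h1 (J + j)
  have h6 := hJ (J + j) (by omega)
  rw [Real.dist_eq, sub_zero] at h6
  replace h6 := (le_abs_self _).trans_lt h6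
  rw [Real.dist_eq, sub_zero, abs_of_nonneg (ha _), add_assoc]
  linarith

/-- Vectors whose orbit under `f` grows slower than `ρ ^ k`. -/
def slowOrbits {E : Type*} [NormedAddCommGroup E] [NormedSpace ℂ E] (f : Module.End ℂ E) (ρ : ℝ) :
    Submodule ℂ E where
  carrier := {x | Filter.Tendsto (fun k : ℕ => (ρ ^ k : ℝ)⁻¹ • ‖(f ^ k) x‖) Filter.atTop (nhds 0)}
  zero_mem' := by simp
  add_mem' := by
    intro x y hx hy
    have h := (tendsto_zero_iff_norm_tendsto_zero.1 hx).add (tendsto_zero_iff_norm_tendsto_zero.1 hy)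
    rw [add_zero] at h
    refine squeeze_zero_norm (fun k => ?_) h
    rw [map_add, norm_smul, norm_smul, norm_smul, ← mul_add, norm_norm, norm_norm, norm_norm]
    exact mul_le_mul_of_nonneg_left (norm_add_le _ _) (norm_nonneg _)
  smul_mem' := by
    intro c x hx
    have h := hx.const_mul ‖c‖
    rw [mul_zero] at h
    refine h.congr fun k => ?_
    rw [map_smul, norm_smul, smul_eq_mul, smul_eq_mul]
    ring

/-- For x killed by (f - z)^(m+1), the vector y = (f - z) x is slow by induction, and f^(k+1) x = z
f^k x + f^k y is a contracting recursion after division by ρ^(k+1). -/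
lemma maxGenEigenspace_le_slowOrbits {E : Type*} [NormedAddCommGroup E] [NormedSpace ℂ E]
    (f : Module.End ℂ E) {ρ : ℝ} {z : ℂ} (hz : ‖z‖ < ρ) :
    f.maxGenEigenspace z ≤ slowOrbits f ρ := by
  intro x hx
  obtain ⟨m, hm⟩ := (f.mem_maxGenEigenspace z x).1 hx
  have hρ : 0 < ρ := (norm_nonneg z).trans_lt hz
  clear hx
  induction m generalizing x with
  | zero =>
    obtain rfl : x = 0 := by simpa using hm
    exact zero_mem _
  | succ m ih =>
    have hy : (f - z • 1) x ∈ slowOrbits f ρ := ih (by rw [← Module.End.mul_apply, ← pow_succ, hm])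
    have hy' : Filter.Tendsto (fun k : ℕ => ρ⁻¹ * ((ρ ^ k : ℝ)⁻¹ • ‖(f ^ k) ((f - z • 1) x)‖))
        Filter.atTop (nhds 0) := by
      simpa using Filter.Tendsto.const_mul ρ⁻¹ hy
    refine tendsto_zero_of_le_mul_add (θ := ‖z‖ / ρ) (fun k => by positivity) (by positivity)
      ((div_lt_one hρ).2 hz) (fun k => ?_) hy'
    have h1 : (f ^ (k + 1)) x = z • (f ^ k) x + (f ^ k) ((f - z • 1) x) := by
      rw [pow_succ, Module.End.mul_apply]
      simp [map_sub]
    have h2 : ‖(f ^ (k + 1)) x‖ ≤ ‖z‖ * ‖(f ^ k) x‖ + ‖(f ^ k) ((f - z • 1) x)‖ := by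
      rw [h1, ← norm_smul]
      exact norm_add_le _ _
    have h3 := mul_le_mul_of_nonneg_left h2 (by positivity : 0 ≤ (ρ ^ (k + 1))⁻¹)
    refine h3.trans (le_of_eq ?_)
    rw [smul_eq_mul, smul_eq_mul, pow_succ]
    field_simp

lemma norm_sq_sum_smul_of_orthonormal {E : Type*} [NormedAddCommGroup E] [InnerProductSpace ℂ E]
    {r : ℕ} {u : Fin r → E} (hu : Orthonormal ℂ u) (l : Fin r → ℂ) :
    ‖∑ j, l j • u j‖ ^ 2 = ∑ j, ‖l j‖ ^ 2 := by
  have h := hu.inner_sum l l Finset.univ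
  rw [inner_self_eq_norm_sq_to_K] at h
  simp only [RCLike.conj_mul] at h
  exact_mod_cast h

/-- A perturbation of an operator of rank `r` has at least `r` large eigenvalues. -/
lemma card_large_roots {E : Type*} [NormedAddCommGroup E] [InnerProductSpace ℂ E]
    [FiniteDimensional ℂ E] {f g : Module.End ℂ E} {r : ℕ} {u : Fin r → E} (hu : Orthonormal ℂ u)
    (c : Fin r → ℂ) (hf : ∀ x, f x = ∑ j, (c j * inner ℂ (u j) x) • u j + g x)
    {lam h : ℝ} (hc : ∀ j, lam ≤ ‖c j‖) (hg : ∀ x, ‖g x‖ ≤ h * ‖x‖) (hlam : 0 < lam)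
    (h4 : 4 * h ≤ lam) :
    r ≤ (f.charpoly.roots.filter fun z => lam / 2 ≤ ‖z‖).card := by
  classical
  by_contra hlt
  push Not at hlt
  set ρ := lam / 2 with hρ
  have hρ0 : 0 < ρ := by positivity
  let P : Module.End ℂ E := ∑ j, (innerₛₗ ℂ (u j)).smulRight (u j)
  have hP : ∀ x, P x = ∑ j, (inner ℂ (u j) x : ℂ) • u j := fun x => by simp [P]
  have hPin : ∀ x j, inner ℂ (u j) (P x) = (inner ℂ (u j) x : ℂ) := fun x j => by
    rw [hP, hu.inner_right_fintype]
  have hPyth : ∀ x, ‖x‖ ^ 2 = ‖P x‖ ^ 2 + ‖x - P x‖ ^ 2 := by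
    intro x
    have h0 : inner ℂ (P x) (x - P x) = (0 : ℂ) := by
      nth_rewrite 1 [hP]
      rw [sum_inner]
      refine Finset.sum_eq_zero fun j _ => ?_
      rw [inner_smul_left, inner_sub_right, hPin, sub_self, mul_zero]
    have := norm_add_sq_eq_norm_sq_add_norm_sq_of_inner_eq_zero (P x) (x - P x) h0
    rw [add_sub_cancel] at this
    simpa only [pow_two] using this
  have hPle : ∀ x, ‖P x‖ ≤ ‖x‖ := fun x =>
    le_of_sq_le_sq (by nlinarith [hPyth x, sq_nonneg ‖x - P x‖]) (norm_nonneg _)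
  have hQle : ∀ x, ‖x - P x‖ ≤ ‖x‖ := fun x =>
    le_of_sq_le_sq (by nlinarith [hPyth x, sq_nonneg ‖P x‖]) (norm_nonneg _)
  set f₀ : E → E := fun x => ∑ j, (c j * inner ℂ (u j) x) • u j with hf₀
  have hPf₀ : ∀ x, P (f₀ x) = f₀ x := by
    intro x
    rw [hP]
    refine Finset.sum_congr rfl fun j _ => ?_
    rw [hf₀, hu.inner_right_fintype]
  have hf₀le : ∀ x, lam * ‖P x‖ ≤ ‖f₀ x‖ := by
    intro x
    refine le_of_sq_le_sq ?_ (norm_nonneg _)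
    rw [hf₀, norm_sq_sum_smul_of_orthonormal hu, mul_pow, hP, norm_sq_sum_smul_of_orthonormal hu,
      Finset.mul_sum]
    refine Finset.sum_le_sum fun j _ => ?_
    rw [norm_mul, mul_pow]
    exact mul_le_mul_of_nonneg_right (pow_le_pow_left₀ hlam.le (hc j) 2) (sq_nonneg _)
  -- In the cone ‖x‖ ≤ 2 ‖P x‖, so 4h ≤ lam gives ‖g x‖ ≤ (lam/2) ‖P x‖. The main part expands `P x`
  -- by at least lam, which leaves a factor ρ = lam/2, and the component of `f x` outside the span
  -- comes from `g` alone.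
  have hcone : ∀ x, ‖x - P x‖ ≤ ‖P x‖ → ρ * ‖P x‖ ≤ ‖P (f x)‖ ∧ ‖f x - P (f x)‖ ≤ ‖P (f x)‖ := by
    intro x hx
    have h1 : ‖x‖ ≤ 2 * ‖P x‖ := by
      have := norm_add_le (P x) (x - P x)
      rw [add_sub_cancel] at this
      linarith
    have h2 : ‖g x‖ ≤ ρ * ‖P x‖ := by
      by_cases hh : 0 ≤ h
      · nlinarith [hg x, norm_nonneg (P x)]
      · have := hg x
        nlinarith [norm_nonneg (P x), norm_nonneg x]
    have h3 : P (f x) = f₀ x + P (g x) := by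
      rw [hf x, map_add]
      exact congrArg (· + _) (hPf₀ x)
    have h5 : f x - P (f x) = g x - P (g x) := by
      rw [h3, hf x]
      abel
    have h6 : ρ * ‖P x‖ ≤ ‖P (f x)‖ := by
      have h7 := norm_sub_le (P (f x)) (P (g x))
      rw [h3, add_sub_cancel_right, ← h3] at h7
      have := hf₀le x
      have := hPle (g x)
      rw [hρ] at h2 ⊢
      linarith
    exact ⟨h6, by rw [h5]; exact (hQle _).trans (h2.trans h6)⟩
  have hgrow : ∀ x, ‖x - P x‖ ≤ ‖P x‖ → ∀ k : ℕ, ρ ^ k * ‖P x‖ ≤ ‖P ((f ^ k) x)‖ ∧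
      ‖(f ^ k) x - P ((f ^ k) x)‖ ≤ ‖P ((f ^ k) x)‖ := by
    intro x hx k
    induction k with
    | zero => simpa using hx
    | succ k ih =>
      rw [pow_succ' f, Module.End.mul_apply]
      obtain ⟨h1, h2⟩ := hcone _ ih.2
      refine ⟨le_trans ?_ h1, h2⟩
      rw [pow_succ', mul_assoc]
      exact mul_le_mul_of_nonneg_left ih.1 hρ0.le
  set S : Submodule ℂ E := Submodule.span ℂ (Set.range u) with hS
  have hSr : Module.finrank ℂ S = r := by
    rw [hS, finrank_span_eq_card hu.linearIndependent, Fintype.card_fin]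
  set Vl : Submodule ℂ E := (f.charpoly.roots.filter fun z => ρ ≤ ‖z‖).toFinset.sup
    fun z => f.maxGenEigenspace z with hVl
  have hVdim : Module.finrank ℂ Vl ≤ (f.charpoly.roots.filter fun z => ρ ≤ ‖z‖).card := by
    rw [← Multiset.toFinset_sum_count_eq, hVl]
    have : ∀ s : Finset ℂ, Module.finrank ℂ (s.sup fun z => f.maxGenEigenspace z : Submodule ℂ E) ≤
        ∑ z ∈ s, Module.finrank ℂ (f.maxGenEigenspace z) := by
      intro s
      induction s using Finset.induction_on with
      | empty => simp
      | insert z s hz ih =>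
        rw [Finset.sup_insert, Finset.sum_insert hz]
        exact (Submodule.finrank_add_le_finrank_add_finrank _ _).trans (Nat.add_le_add_left ih _)
    refine (this _).trans (Finset.sum_le_sum fun z hz => ?_)
    rw [LinearMap.finrank_maxGenEigenspace_eq, Multiset.count_filter,
      if_pos (Multiset.mem_filter.1 (Multiset.mem_toFinset.1 hz)).2, Polynomial.count_roots]
  have hsup : slowOrbits f ρ ⊔ Vl = ⊤ := by
    rw [eq_top_iff, ← Module.End.iSup_maxGenEigenspace_eq_top f]
    refine iSup_le fun z => ?_
    by_cases hz : ‖z‖ < ρ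
    · exact (maxGenEigenspace_le_slowOrbits f hz).trans le_sup_left
    · by_cases hr : z ∈ f.charpoly.roots
      · refine le_trans ?_ le_sup_right
        exact Finset.le_sup (f := fun z => f.maxGenEigenspace z)
          (Multiset.mem_toFinset.2 (Multiset.mem_filter.2 ⟨hr, not_lt.1 hz⟩))
      · have : f.maxGenEigenspace z = ⊥ := by
          rw [← Submodule.finrank_eq_zero (R := ℂ), LinearMap.finrank_maxGenEigenspace_eq,
            ← Polynomial.count_roots, Multiset.count_eq_zero_of_notMem hr]
        rw [this]
        exact bot_le
  -- `S` has dimension r while `slowOrbits` has codimension at most dim `Vl` < r.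
  have hne : S ⊓ slowOrbits f ρ ≠ ⊥ := by
    intro hbot
    have h1 := Submodule.finrank_sup_add_finrank_inf_eq S (slowOrbits f ρ)
    have h2 := Submodule.finrank_add_le_finrank_add_finrank (slowOrbits f ρ) Vl
    have h3 := Submodule.finrank_le (S ⊔ slowOrbits f ρ)
    rw [hbot, finrank_bot, add_zero] at h1
    rw [hsup, finrank_top] at h2
    omega
  obtain ⟨x, hx, hx0⟩ := Submodule.exists_mem_ne_zero_of_ne_bot hne
  have hPx : P x = x := by
    have hxS : x ∈ S := (Submodule.mem_inf.1 hx).1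
    rw [hS, Submodule.mem_span_range_iff_exists_fun] at hxS
    obtain ⟨d, rfl⟩ := hxS
    rw [hP]
    exact Finset.sum_congr rfl fun j _ => by rw [hu.inner_right_fintype]
  have hlim : Filter.Tendsto (fun k : ℕ => (ρ ^ k : ℝ)⁻¹ • ‖(f ^ k) x‖) Filter.atTop (nhds 0) :=
    (Submodule.mem_inf.1 hx).2
  have hge : ∀ k : ℕ, ‖x‖ ≤ (ρ ^ k : ℝ)⁻¹ • ‖(f ^ k) x‖ := by
    intro k
    have h1 := (hgrow x (by rw [hPx, sub_self, norm_zero]; exact norm_nonneg _) k).1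
    rw [hPx] at h1
    rw [smul_eq_mul, inv_mul_eq_div, le_div_iff₀ (by positivity), mul_comm]
    exact h1.trans (hPle _)
  exact hx0 (norm_le_zero_iff.1 (ge_of_tendsto' hlim hge))

/-- The complexification of a real vector. -/
noncomputable def toComplex {n : ℕ} (v : EuclideanSpace ℝ (Fin n)) : EuclideanSpace ℂ (Fin n) :=
  WithLp.toLp 2 fun i => (v i : ℂ)

lemma inner_toComplex {n : ℕ} (v : EuclideanSpace ℝ (Fin n)) (x : EuclideanSpace ℂ (Fin n)) :
    inner ℂ (toComplex v) x = ∑ k, (v k : ℂ) * x k := by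
  simp [toComplex, PiLp.inner_apply, mul_comm]

lemma orthonormal_toComplex {n r : ℕ} {u : Fin r → EuclideanSpace ℝ (Fin n)}
    (hu : Orthonormal ℝ u) : Orthonormal ℂ fun j => toComplex (u j) := by
  rw [orthonormal_iff_ite] at hu ⊢
  intro i j
  rw [inner_toComplex]
  have h := congrArg (Complex.ofReal) (hu i j)
  simp only [PiLp.inner_apply, toComplex] at h ⊢
  simp only [RCLike.inner_apply, conj_trivial] at h
  rw [Complex.ofReal_sum] at h
  refine Eq.trans (Finset.sum_congr rfl fun k _ => ?_) (h.trans ?_)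
  · rw [Complex.ofReal_mul, mul_comm]
  · split_ifs <;> simp

open scoped Matrix.Norms.L2Operator in
-- At least r eigenvalues have modulus t/2 or more, and by the ordering these include the first r.
lemma le_norm_eigenvalue {n r : ℕ} (hrn : r ≤ n) {Mstar H : Matrix (Fin n) (Fin n) ℝ}
    {lamS : Fin r → ℝ} {uS : Fin r → EuclideanSpace ℝ (Fin n)} (hM : IsEigenDecomp Mstar lamS uS)
    {t : ℝ} (ht : 0 < t) (hlam : ∀ j, t ≤ |lamS j|) (hH : 4 * ‖H.map Complex.ofReal‖ ≤ t)
    {lam : Fin n → ℂ} (hl : IsEigenvalueList (Mstar + H) lam) (ℓ : Fin r) :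
    t / 2 ≤ ‖lam (Fin.castLE hrn ℓ)‖ := by
  classical
  set f : Module.End ℂ (EuclideanSpace ℂ (Fin n)) :=
    Matrix.toLpLin 2 2 ((Mstar + H).map Complex.ofReal) with hf
  have hchar : f.charpoly = ((Mstar + H).map Complex.ofReal).charpoly := by
    rw [hf, Matrix.toLpLin_eq_toLin,
      ← LinearMap.charpoly_toMatrix _ (PiLp.basisFun 2 ℂ (Fin n)), LinearMap.toMatrix_toLin]
  have hcard := card_large_roots (f := f)
    (g := (Matrix.toEuclideanCLM (n := Fin n) (𝕜 := ℂ) (H.map Complex.ofReal) : Module.End ℂ _))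
    (orthonormal_toComplex hM.orthonormal) (fun j => (lamS j : ℂ)) ?_ (lam := t)
    (h := ‖H.map Complex.ofReal‖) (fun j => by simpa using hlam j) (fun x => ?_) ht hH
  · rw [hchar, hl.1] at hcard
    by_contra hlt
    push Not at hlt
    -- If `lam ℓ` were small, every large eigenvalue would have index below ℓ, leaving fewer than r
    -- of them.
    have h1 : ((Multiset.map lam Finset.univ.val).filter fun z => t / 2 ≤ ‖z‖).card ≤
        ℓ.val := by
      rw [Multiset.filter_map, Multiset.card_map]
      change (Finset.univ.filter fun i => t / 2 ≤ ‖lam i‖).card ≤ _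
      calc _ ≤ (Finset.univ.filter fun i : Fin n => i < Fin.castLE hrn ℓ).card := by
            refine Finset.card_le_card fun i hi => ?_
            simp only [Finset.mem_filter, Finset.mem_univ, true_and] at hi ⊢
            by_contra hge
            have := hl.2 (not_lt.1 hge)
            simp only at this
            linarith
        _ = _ := by
            rw [Finset.filter_gt_eq_Iio, Fin.card_Iio]
            rfl
    have := ℓ.isLt
    omega
  · intro x
    ext i
    have h1 : (f x) i = ∑ k, ((Mstar + H) i k : ℂ) * x k := by
      simp [hf, Matrix.mulVec, dotProduct]
    have h2 : (Matrix.toEuclideanCLM (n := Fin n) (𝕜 := ℂ) (H.map Complex.ofReal) x) i =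
        ∑ k, (H i k : ℂ) * x k := by
      simp [Matrix.mulVec, dotProduct]
    rw [h1, PiLp.add_apply]
    refine Eq.trans ?_ (congrArg (_ + ·) h2.symm)
    simp only [WithLp.ofLp_sum, WithLp.ofLp_smul, Finset.sum_apply, Pi.smul_apply, smul_eq_mul,
      inner_toComplex, Matrix.add_apply, hM.eq_sum]
    simp only [toComplex, Complex.ofReal_add, Complex.ofReal_sum, Complex.ofReal_mul, add_mul,
      Finset.sum_add_distrib, Finset.sum_mul, Finset.mul_sum]
    rw [Finset.sum_comm]
    congr 1
    exact Finset.sum_congr rfl fun j _ => Finset.sum_congr rfl fun k _ => by ring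
  · exact (Matrix.toEuclideanCLM (n := Fin n) (𝕜 := ℂ) (H.map Complex.ofReal)).le_opNorm x

/-! ### The truncated Neumann series -/

lemma abs_le_lamMax {r : ℕ} (lam : Fin r → ℝ) (j : Fin r) : |lam j| ≤ lamMax lam :=
  le_ciSup (f := fun j => |lam j|) (Set.finite_range _).bddAbove j

lemma lamMin_le_abs {r : ℕ} (lam : Fin r → ℝ) (j : Fin r) : lamMin lam ≤ |lam j| :=
  ciInf_le (f := fun j => |lam j|) (Set.finite_range _).bddBelow j

lemma lamMin_pos {r : ℕ} {lam : Fin r → ℝ} (h : ∀ j, lam j ≠ 0) (j₀ : Fin r) : 0 < lamMin lam := by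
  have : Nonempty (Fin r) := ⟨j₀⟩
  obtain ⟨j, hj⟩ := exists_eq_ciInf_of_finite (f := fun j => |lam j|)
  rw [lamMin, ← hj]
  exact abs_pos.2 (h j)

lemma norm_toComplex {n : ℕ} (v : EuclideanSpace ℝ (Fin n)) : ‖toComplex v‖ = ‖v‖ := by
  simp [toComplex, EuclideanSpace.norm_eq]

lemma sum_norm_inner_le {E : Type*} [NormedAddCommGroup E] [InnerProductSpace ℂ E] {r : ℕ}
    {v : Fin r → E} (hv : Orthonormal ℂ v) {x : E} (hx : ‖x‖ = 1) :
    ∑ j, ‖(inner ℂ (v j) x : ℂ)‖ ≤ √r := by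
  refine Real.le_sqrt_of_sq_le ?_
  have h1 := hv.sum_inner_products_le (x := x) (s := Finset.univ)
  have h2 := sq_sum_le_card_mul_sum_sq (s := Finset.univ) (f := fun j => ‖(inner ℂ (v j) x : ℂ)‖)
  rw [Finset.card_univ, Fintype.card_fin] at h2
  refine h2.trans ?_
  rw [hx, one_pow] at h1
  exact mul_le_of_le_one_right (by positivity) h1

open scoped Matrix.Norms.L2Operator in
/-- The Neumann series for the eigenvector, tested against `a`. -/
lemma norm_linForm_le {n r : ℕ} {Mstar H : Matrix (Fin n) (Fin n) ℝ} {lamS : Fin r → ℝ}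
    {uS : Fin r → EuclideanSpace ℝ (Fin n)} (hM : IsEigenDecomp Mstar lamS uS)
    {a : EuclideanSpace ℝ (Fin n)} (ha : ‖a‖ = 1) {β T : ℝ} {p : ℕ}
    (hbil : ∀ s < p, ∀ j, |∑ i, ∑ k, a i * (H ^ (s + 1)) i k * uS j k| ≤ β * T ^ (s + 1))
    (hop : ‖H.map Complex.ofReal‖ ≤ T) (hβ : 0 ≤ β) {z : ℂ} (hz : 3 * T ≤ ‖z‖) (hz0 : z ≠ 0)
    {u : EuclideanSpace ℂ (Fin n)} (hu : IsUnitEigenvector (Mstar + H) z u) :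
    ‖linForm a lamS uS z u‖ ≤
      lamMax lamS / ‖z‖ * √r * β * (2 * (T / ‖z‖)) + T / ‖z‖ * (1 / 3) ^ p := by
  have hT : 0 ≤ T := (norm_nonneg _).trans hop
  have hzp : 0 < ‖z‖ := norm_pos_iff.2 hz0
  set Hc := H.map Complex.ofReal with hHc
  set ac : Fin n → ℂ := fun i => (a i : ℂ) with hac
  set c : Fin r → ℂ := fun j => ∑ k, (uS j k : ℂ) * u k with hcd
  set b : Fin r → Fin n → ℂ := fun j k => (uS j k : ℂ) with hb
  set v : Fin n → ℂ := ∑ j, ((lamS j : ℂ) * c j) • b j with hv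
  set y : ℕ → ℂ := fun s => ac ⬝ᵥ (Hc ^ s).mulVec u.ofLp with hy
  set w : ℕ → ℂ := fun s => ac ⬝ᵥ (Hc ^ s).mulVec v with hw
  have hHpow : ∀ s i k, (Hc ^ s) i k = ((H ^ s) i k : ℂ) := by
    intro s i k
    have := map_pow (Complex.ofRealHom.mapMatrix (m := Fin n)) H s
    exact (congrFun (congrFun this i) k).symm
  have heig : z • u.ofLp = v + Hc.mulVec u.ofLp := by
    ext i
    rw [Pi.smul_apply, smul_eq_mul, ← hu.2 i]
    simp only [hv, hb, hcd, hHc, Pi.add_apply, Finset.sum_apply, Pi.smul_apply, smul_eq_mul,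
      Matrix.mulVec, dotProduct, Matrix.map_apply, Matrix.add_apply, hM.eq_sum,
      Complex.ofReal_add, Complex.ofReal_sum, Complex.ofReal_mul, add_mul,
      Finset.sum_add_distrib, Finset.sum_mul, Finset.mul_sum]
    rw [Finset.sum_comm]
    congr 1
    exact Finset.sum_congr rfl fun j _ => Finset.sum_congr rfl fun k _ => by ring
  -- `y s` is aᵀ H^s u, and `w s` is aᵀ H^s applied to the low-rank part of z u. The linear form is
  -- `y 0` without its first term `w 0 / z`.
  have hrec : ∀ s, y s = (w s + y (s + 1)) / z := by
    intro s
    rw [eq_div_iff hz0, mul_comm]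
    simp only [hy, hw]
    rw [← smul_eq_mul, ← dotProduct_smul, ← Matrix.mulVec_smul, heig, Matrix.mulVec_add,
      dotProduct_add, Matrix.mulVec_mulVec, ← pow_succ]
  have hlin : linForm a lamS uS z u = y 0 - w 0 / z := by
    simp only [linForm, hy, hw, hv, hac, hb, hcd, pow_zero, Matrix.one_mulVec, dotProduct,
      Finset.sum_apply, Pi.smul_apply, smul_eq_mul, mul_sub, Finset.sum_sub_distrib,
      Finset.sum_div, Finset.mul_sum]
    congr 1
    refine Finset.sum_congr rfl fun i _ => Finset.sum_congr rfl fun j _ => ?_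
    rw [← Finset.sum_div, ← Finset.mul_sum]
    ring
  have hexp : ∀ p : ℕ, y 0 - w 0 / z =
      ∑ s ∈ Finset.range p, w (s + 1) / z ^ (s + 2) + y (p + 1) / z ^ (p + 1) := by
    intro p
    induction p with
    | zero =>
      rw [hrec 0]
      simp
      ring
    | succ p ih =>
      rw [ih, Finset.sum_range_succ, hrec (p + 1)]
      field_simp
      ring
  have hc1 : ∑ j, ‖c j‖ ≤ √r := by
    have := sum_norm_inner_le (orthonormal_toComplex hM.orthonormal) hu.1
    simpa only [inner_toComplex] using this
  have hmax0 : ∀ j : Fin r, 0 ≤ lamMax lamS := fun j => (abs_nonneg _).trans (abs_le_lamMax lamS j)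
  have hwle : ∀ s < p, ‖w (s + 1)‖ ≤ lamMax lamS * √r * (β * T ^ (s + 1)) := by
    intro s hs
    have h1 : w (s + 1) = ∑ j, ((lamS j : ℂ) * c j) *
        ((∑ i, ∑ k, a i * (H ^ (s + 1)) i k * uS j k : ℝ) : ℂ) := by
      simp only [hw, hv, Matrix.mulVec_sum, dotProduct_sum, Matrix.mulVec_smul, dotProduct_smul,
        smul_eq_mul]
      refine Finset.sum_congr rfl fun j _ => ?_
      congr 1
      simp only [dotProduct, Matrix.mulVec, hHpow, hac, hb, Complex.ofReal_sum,
        Complex.ofReal_mul, Finset.mul_sum, mul_assoc]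
    rw [h1]
    calc _ ≤ ∑ j, lamMax lamS * ‖c j‖ * (β * T ^ (s + 1)) := by
          refine (norm_sum_le _ _).trans (Finset.sum_le_sum fun j _ => ?_)
          rw [norm_mul, norm_mul, Complex.norm_real, Complex.norm_real]
          have h2 := hmax0 j
          exact mul_le_mul (mul_le_mul_of_nonneg_right (abs_le_lamMax lamS j) (norm_nonneg _))
            (hbil s hs j) (norm_nonneg _) (by positivity)
      _ = lamMax lamS * (∑ j, ‖c j‖) * (β * T ^ (s + 1)) := by
          rw [Finset.mul_sum, Finset.sum_mul]
      _ ≤ _ := by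
          rcases r with _ | r
          · simp
          · have h2 := hmax0 0
            gcongr
  have hyle : ∀ s, ‖y s‖ ≤ T ^ s := by
    intro s
    have h1 : y s = inner ℂ (toComplex a) (Matrix.toEuclideanCLM (n := Fin n) (𝕜 := ℂ) (Hc ^ s) u) := by
      rw [inner_toComplex]
      simp only [hy, Matrix.ofLp_toEuclideanCLM, dotProduct, hac]
    rw [h1]
    refine (norm_inner_le_norm _ _).trans ?_
    rw [norm_toComplex, ha, one_mul]
    refine (ContinuousLinearMap.le_opNorm _ _).trans ?_
    rw [hu.1, mul_one, ← Matrix.cstar_norm_def]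
    rcases s with _ | s
    · rw [pow_zero, pow_zero, Matrix.cstar_norm_def, map_one]
      exact ContinuousLinearMap.norm_id_le
    · exact (norm_pow_le' _ (Nat.succ_pos s)).trans (pow_le_pow_left₀ (norm_nonneg _) hop _)
  set x := T / ‖z‖ with hx
  have hx0 : 0 ≤ x := by positivity
  have hx3 : x ≤ 1 / 3 := by
    rw [hx, div_le_iff₀ hzp]
    linarith
  rw [hlin, hexp p]
  refine (norm_add_le _ _).trans (add_le_add ?_ ?_)
  · have h1 : ∀ s ∈ Finset.range p, ‖w (s + 1) / z ^ (s + 2)‖ ≤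
        lamMax lamS / ‖z‖ * √r * β * x * x ^ s := by
      intro s hs
      rw [norm_div, norm_pow, div_le_iff₀ (by positivity)]
      refine (hwle s (Finset.mem_range.1 hs)).trans (le_of_eq ?_)
      rw [hx, div_pow]
      field_simp
      ring
    -- The ratio is at most 1/3, since |z| ≥ 3T.
    have h2 : ∑ s ∈ Finset.range p, x ^ s ≤ 2 := by
      have h3 := geom_sum_mul x p
      have h4 : 0 ≤ ∑ s ∈ Finset.range p, x ^ s := Finset.sum_nonneg fun s _ => pow_nonneg hx0 s
      nlinarith [pow_nonneg hx0 p]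
    refine (norm_sum_le _ _).trans ((Finset.sum_le_sum h1).trans ?_)
    rw [← Finset.mul_sum]
    rcases r with _ | r
    · simp
    · have h3 := hmax0 0
      calc _ ≤ lamMax lamS / ‖z‖ * √(r + 1 : ℕ) * β * x * 2 :=
            mul_le_mul_of_nonneg_left h2 (by positivity)
        _ = _ := by ring
  · rw [norm_div, norm_pow]
    calc _ ≤ T ^ (p + 1) / ‖z‖ ^ (p + 1) := by
          gcongr
          exact hyle _
      _ = x * x ^ p := by rw [← div_pow, ← hx, pow_succ']
      _ ≤ _ := mul_le_mul_of_nonneg_left (pow_le_pow_left₀ hx0 hx3 p) hx0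

/-! ### The good event and the conclusion -/

open scoped Matrix.Norms.L2Operator in
/-- The noise is small in spectral norm, and so are the bilinear forms of its powers between `a` and
the vectors `u j`. -/
def NoiseBound {n r : ℕ} (a : EuclideanSpace ℝ (Fin n)) (u : Fin r → EuclideanSpace ℝ (Fin n))
    (β T : ℝ) (p : ℕ) (H : Matrix (Fin n) (Fin n) ℝ) : Prop :=
  ‖H.map Complex.ofReal‖ ≤ T ∧
    ∀ s < p, ∀ j, |∑ i, ∑ k, a i * (H ^ (s + 1)) i k * u j k| ≤ β * T ^ (s + 1)

lemma ae_eq_zero_of_sigma_eq_zero {n : ℕ} {Ω : Type*} [MeasurableSpace Ω] {P : Measure Ω}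
    [IsProbabilityMeasure P] {H : Ω → Matrix (Fin n) (Fin n) ℝ} {B : ℝ} (hH : IsNoise P H 0 B) :
    ∀ᵐ ω ∂P, H ω = 0 := by
  have h : ∀ i j, ∀ᵐ ω ∂P, H ω i j = 0 := by
    intro i j
    have hX : MemLp (fun ω => H ω i j) 2 P :=
      MemLp.of_bound (hH.measurable i j).aestronglyMeasurable B (by simpa using hH.bounded i j)
    have hv : variance (fun ω => H ω i j) P = 0 :=
      le_antisymm (by simpa using hH.variance_le i j) (variance_nonneg _ _)
    filter_upwards [ae_eq_integral_of_variance_eq_zero hX hv] with ω hω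
    rw [hω, hH.mean_zero i j]
  filter_upwards [ae_all_iff.2 fun i => ae_all_iff.2 fun j => h i j] with ω hω
  ext i j
  exact hω i j

open scoped Matrix.Norms.L2Operator in
-- A union bound: at most n² pairs of a power and a vector, each failing with probability at most
-- n^{-12}, and the norm bound failing with probability at most n^{-11}.
lemma measure_not_noiseBound_le {n r : ℕ} (hn : 3 ≤ n) (hrn : r ≤ n) {Ω : Type*}
    [MeasurableSpace Ω] {P : Measure Ω} [IsProbabilityMeasure P]
    {H : Ω → Matrix (Fin n) (Fin n) ℝ} {σ B : ℝ} (hσ : 0 ≤ σ) (hH : IsNoise P H σ B)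
    {a : EuclideanSpace ℝ (Fin n)} (ha : ‖a‖ = 1) {u : Fin r → EuclideanSpace ℝ (Fin n)} {β : ℝ}
    (hβ : 0 < β) (hu : ∀ j i, |u j i| ≤ β) :
    P {ω | ¬ NoiseBound a u β (1800 * noiseLevel n σ B) ⌈Real.log n⌉₊ (H ω)} ≤
      ENNReal.ofReal (2 / (n : ℝ) ^ 10) := by
  have hlog := one_le_log_of_three_le hn
  have hn0 : (0 : ℝ) < n := by positivity
  have hL0 : 0 ≤ noiseLevel n σ B := le_max_of_le_left (by positivity)
  -- The moment bounds divide by the noise level. If it vanishes, then σ = 0 and the noise is almost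
  -- surely zero.
  rcases hL0.eq_or_lt with hL | hL
  · have hσ0 : σ = 0 := by
      have h1 : σ * √(n * Real.log n) ≤ 0 := hL ▸ le_max_left _ _
      have h2 : 0 < √(n * Real.log n) := Real.sqrt_pos.2 (by positivity)
      exact le_antisymm (nonpos_of_mul_nonpos_left h1 h2) hσ
    subst hσ0
    refine le_trans (le_of_eq ?_) zero_le
    refine measure_mono_null (fun ω hω (h0 : H ω = 0) => hω ?_)
      (ae_iff.1 (ae_eq_zero_of_sigma_eq_zero hH))
    rw [h0]
    refine ⟨?_, fun s _ j => ?_⟩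
    · rw [← hL, mul_zero, Matrix.map_zero _ Complex.ofReal_zero, norm_zero]
    · rw [zero_pow (Nat.succ_ne_zero s)]
      simp only [Matrix.zero_apply, mul_zero, zero_mul, Finset.sum_const_zero, abs_zero]
      positivity
  · set ℓ := ⌈Real.log n⌉₊ with hℓ
    set L := noiseLevel n σ B with hLd
    have ha2 : ∑ i, a i ^ 2 ≤ 1 := by
      have := EuclideanSpace.real_norm_sq_eq a
      rw [ha, one_pow] at this
      exact this.symm.le
    set A : Set Ω := {ω | 150 * L < ‖(H ω).map Complex.ofReal‖} with hA
    set D : Fin ℓ × Fin r → Set Ω := fun x => {ω | β * (1800 * L) ^ (x.1.val + 1) ≤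
      |∑ i, ∑ k, a i * (H ω ^ (x.1.val + 1)) i k * u x.2 k|} with hD
    have hsub : {ω | ¬ NoiseBound a u β (1800 * L) ℓ (H ω)} ⊆ A ∪ ⋃ x, D x := by
      intro ω hω
      by_contra hcon
      rw [Set.mem_union, Set.mem_iUnion, not_or, not_exists] at hcon
      refine hω ⟨(not_lt.1 hcon.1).trans (by linarith), fun s hs j => ?_⟩
      exact (not_le.1 (hcon.2 (⟨s, hs⟩, j))).le
    have hAle : P.real A ≤ 1 / (n : ℝ) ^ 11 := measureReal_opNorm_le hn hσ hH hL
    have hDle : ∀ x, P.real (D x) ≤ 1 / (n : ℝ) ^ 12 := fun x =>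
      measureReal_bilin_le hn hσ hH hL ha2 hβ (hu x.2) (by have := x.1.isLt; omega)
    have hℓn : ℓ ≤ n := by
      rw [hℓ, Nat.ceil_le]
      linarith [Real.log_le_sub_one_of_pos hn0]
    rw [← ofReal_measureReal]
    refine ENNReal.ofReal_le_ofReal ?_
    calc _ ≤ P.real A + ∑ x, P.real (D x) :=
          (measureReal_mono hsub).trans ((measureReal_union_le _ _).trans
            (add_le_add_right (measureReal_iUnion_fintype_le _) _))
      _ ≤ 1 / (n : ℝ) ^ 11 + ∑ x : Fin ℓ × Fin r, 1 / (n : ℝ) ^ 12 :=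
          add_le_add hAle (Finset.sum_le_sum fun x _ => hDle x)
      _ ≤ 1 / (n : ℝ) ^ 10 + (n * n) * (1 / (n : ℝ) ^ 12) := by
          rw [Finset.sum_const, Finset.card_univ, Fintype.card_prod, Fintype.card_fin,
            Fintype.card_fin, nsmul_eq_mul, Nat.cast_mul]
          have h1 : (ℓ : ℝ) ≤ n := by exact_mod_cast hℓn
          have h2 : (r : ℝ) ≤ n := by exact_mod_cast hrn
          have h3 : (1 : ℝ) ≤ n := by exact_mod_cast (by omega : 1 ≤ n)
          gcongr
          norm_num
      _ = _ := by field_simp; norm_num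

/-- A unit vector cannot have all entries small. This bounds √(μ/n) from below, so that the
truncation error can be absorbed. -/
lemma one_le_mul_sq_of_isIncoherent {n r : ℕ} {u : Fin r → EuclideanSpace ℝ (Fin n)} {μ : ℝ}
    (hu : Orthonormal ℝ u) (hμ : IsIncoherent u μ) (j : Fin r) : 1 ≤ n * √(μ / n) ^ 2 := by
  have h := EuclideanSpace.real_norm_sq_eq (u j)
  rw [hu.norm_eq_one, one_pow] at h
  rw [h]
  calc _ ≤ ∑ i : Fin n, √(μ / n) ^ 2 := by
        refine Finset.sum_le_sum fun i _ => ?_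
        rw [← sq_abs]
        exact pow_le_pow_left₀ (abs_nonneg _) (hμ j i) 2
    _ = _ := by simp

lemma linForm_bounds {n r : ℕ} (hn : 3 ≤ n) (hrn : r ≤ n) {Mstar H : Matrix (Fin n) (Fin n) ℝ}
    {lamS : Fin r → ℝ} {uS : Fin r → EuclideanSpace ℝ (Fin n)} {μ L : ℝ}
    (hM : IsEigenDecomp Mstar lamS uS) (hμ : IsIncoherent uS μ) (hL : 0 ≤ L)
    (hsmall : L / lamMax lamS ≤ (1 / 10800) / cond lamS) {a : EuclideanSpace ℝ (Fin n)}
    (ha : ‖a‖ = 1) (hH : NoiseBound a uS (√(μ / n)) (1800 * L) ⌈Real.log n⌉₊ H) (ℓ : Fin r)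
    {lam : Fin n → ℂ} {u : EuclideanSpace ℂ (Fin n)} (hl : IsEigenvalueList (Mstar + H) lam)
    (hu : IsUnitEigenvector (Mstar + H) (lam (Fin.castLE hrn ℓ)) u) :
    lam (Fin.castLE hrn ℓ) ≠ 0 ∧
    ‖linForm a lamS uS (lam (Fin.castLE hrn ℓ)) u‖
      ≤ 9000 * (L * (cond lamS / ‖lam (Fin.castLE hrn ℓ)‖) * √(μ * r / n)) ∧
    L * (cond lamS / ‖lam (Fin.castLE hrn ℓ)‖) * √(μ * r / n)
      ≤ 9000 * (L / lamMax lamS * cond lamS ^ 2 * √(μ * r / n)) := by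
  have hmin := lamMin_pos hM.ne_zero ℓ
  have hminmax : lamMin lamS ≤ lamMax lamS := (lamMin_le_abs lamS ℓ).trans (abs_le_lamMax lamS ℓ)
  have hmax : 0 < lamMax lamS := hmin.trans_le hminmax
  -- 10800 = 2 · 3 · 1800: it yields 3 · 1800 L ≤ `lamMin` / 2 ≤ ‖z‖ for the Neumann series, and
  -- also 4 ‖H‖ ≤ `lamMin`.
  have hLsmall : 10800 * L ≤ lamMin lamS := by
    rw [cond, div_div_eq_mul_div, div_le_div_iff_of_pos_right hmax] at hsmall
    linarith
  have hlow : lamMin lamS / 2 ≤ ‖lam (Fin.castLE hrn ℓ)‖ :=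
    le_norm_eigenvalue hrn hM hmin (lamMin_le_abs lamS) (by linarith [hH.1]) hl ℓ
  set z := lam (Fin.castLE hrn ℓ) with hz
  have hz0 : 0 < ‖z‖ := by linarith
  have hzne : z ≠ 0 := norm_pos_iff.1 hz0
  set β := √(μ / n) with hβ
  have hsq : √(μ * r / n) = √r * β := by
    rw [hβ, ← Real.sqrt_mul (by positivity)]
    congr 1
    ring
  have hr1 : (1 : ℝ) ≤ √r := by
    rw [Real.one_le_sqrt]
    exact_mod_cast (by have := ℓ.isLt; omega : 1 ≤ r)
  have hβ0 : 0 ≤ β := Real.sqrt_nonneg _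
  have hn1 : (1 : ℝ) ≤ n := by exact_mod_cast (by omega : 1 ≤ n)
  have hnβ : 1 / (n : ℝ) ≤ β := by
    have h1 := one_le_mul_sq_of_isIncoherent hM.orthonormal hμ ℓ
    rw [div_le_iff₀ (by linarith)]
    by_contra hlt
    push Not at hlt
    nlinarith
  have hκ : 0 < cond lamS := div_pos hmax hmin
  have hκ1 : 1 ≤ cond lamS := (one_le_div hmin).2 hminmax
  have hκz : lamMax lamS / ‖z‖ ≤ 2 * cond lamS := by
    rw [cond, div_le_iff₀ hz0]
    have : lamMax lamS = 2 * (lamMax lamS / lamMin lamS) * (lamMin lamS / 2) := by field_simp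
    nth_rewrite 1 [this]
    exact mul_le_mul_of_nonneg_left hlow (by positivity)
  refine ⟨hzne, ?_, ?_⟩
  · have h := norm_linForm_le hM ha hH.2 hH.1 hβ0 (by linarith) hzne hu
    refine h.trans ?_
    rw [hsq]
    have h3 : (1 / 3 : ℝ) ^ ⌈Real.log n⌉₊ ≤ 1 / n := by
      simpa using inv_three_pow_le (k := 1) hn (by rw [one_mul])
    set x := 1800 * L / ‖z‖ with hx
    have hx0 : 0 ≤ x := by positivity
    have h4 : lamMax lamS / ‖z‖ * √r * β * (2 * x) ≤ 2 * cond lamS * √r * β * (2 * x) := by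
      gcongr
    have h5 : x * (1 / 3) ^ ⌈Real.log n⌉₊ ≤ x * (cond lamS * (√r * β)) := by
      refine mul_le_mul_of_nonneg_left ((h3.trans hnβ).trans ?_) hx0
      have h6 : β ≤ √r * β := le_mul_of_one_le_left hβ0 hr1
      exact h6.trans (le_mul_of_one_le_left (by positivity) hκ1)
    -- The series contributes 2 · 2 · 1800 and the remainder 1800, which together make 9000.
    refine (add_le_add h4 h5).trans (le_of_eq ?_)
    rw [hx]
    ring
  · have h1 : cond lamS / ‖z‖ ≤ 2 * (cond lamS ^ 2 / lamMax lamS) := by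
      rw [div_le_iff₀ hz0]
      have : cond lamS = 2 * (cond lamS ^ 2 / lamMax lamS) * (lamMin lamS / 2) := by
        rw [cond]; field_simp
      nth_rewrite 1 [this]
      exact mul_le_mul_of_nonneg_left hlow (by positivity)
    calc _ ≤ L * (2 * (cond lamS ^ 2 / lamMax lamS)) * √(μ * r / n) := by gcongr
      _ = 2 * (L / lamMax lamS * cond lamS ^ 2 * √(μ * r / n)) := by ring
      _ ≤ _ := mul_le_mul_of_nonneg_right (by norm_num) (by positivity)

end AsymPert

theorem mainTheorem1 :
    ∃ c₁ C K : ℝ, 0 < c₁ ∧ 0 < C ∧ 0 < K ∧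
      ∀ (n r : ℕ) (hrn : r ≤ n)
        (Mstar : Matrix (Fin n) (Fin n) ℝ)
        (lamS : Fin r → ℝ) (uS : Fin r → EuclideanSpace ℝ (Fin n)) (μ : ℝ)
        (Ω : Type*) [MeasurableSpace Ω] (P : Measure Ω) [IsProbabilityMeasure P]
        (H : Ω → Matrix (Fin n) (Fin n) ℝ) (σ B : ℝ),
        Mstar.IsSymm → Mstar.rank = r →
        AsymPert.IsEigenDecomp Mstar lamS uS →
        AsymPert.IsIncoherent uS μ →
        0 ≤ σ → AsymPert.IsNoise P H σ B →
        AsymPert.noiseLevel n σ B / AsymPert.lamMax lamS ≤ c₁ / AsymPert.cond lamS →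
        ∀ (a : EuclideanSpace ℝ (Fin n)), ‖a‖ = 1 → ∀ ℓ : Fin r,
          P {ω | ¬ ∀ (lam : Fin n → ℂ) (u : EuclideanSpace ℂ (Fin n)),
              AsymPert.IsEigenvalueList (Mstar + H ω) lam →
              AsymPert.IsUnitEigenvector (Mstar + H ω) (lam (Fin.castLE hrn ℓ)) u →
                lam (Fin.castLE hrn ℓ) ≠ 0 ∧
                ‖AsymPert.linForm a lamS uS (lam (Fin.castLE hrn ℓ)) u‖
                  ≤ C * (AsymPert.noiseLevel n σ B *
                      (AsymPert.cond lamS / ‖lam (Fin.castLE hrn ℓ)‖) * √(μ * r / n)) ∧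
                AsymPert.noiseLevel n σ B *
                    (AsymPert.cond lamS / ‖lam (Fin.castLE hrn ℓ)‖) * √(μ * r / n)
                  ≤ C * (AsymPert.noiseLevel n σ B / AsymPert.lamMax lamS *
                      AsymPert.cond lamS ^ 2 * √(μ * r / n))}
            ≤ ENNReal.ofReal (K / (n : ℝ) ^ 10) := by
  refine ⟨1 / 10800, 9000, 2 ^ 10, by norm_num, by norm_num, by norm_num, ?_⟩
  intro n r hrn Mstar lamS uS μ Ω _ P _ H σ B _ _ hM hμ hσ hH hsmall a ha ℓ
  have hr : 1 ≤ r := by have := ℓ.isLt; omega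
  have hn0 : (0 : ℝ) < n := by exact_mod_cast (by omega : 0 < n)
  by_cases hn : 3 ≤ n
  · have hβ : 0 < √(μ / n) := by
      have h1 := AsymPert.one_le_mul_sq_of_isIncoherent hM.orthonormal hμ ℓ
      refine (Real.sqrt_nonneg _).lt_of_ne fun h0 => ?_
      rw [← h0] at h1
      norm_num at h1
    have hL : 0 ≤ AsymPert.noiseLevel n σ B := le_max_of_le_left (by positivity)
    refine (measure_mono ?_).trans
      ((AsymPert.measure_not_noiseBound_le hn hrn hσ hH ha hβ hμ).trans ?_)
    -- On the good event the bounds are deterministic, so they hold for all orderings and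
    -- eigenvectors at once.
    · intro ω hω hgood
      exact hω fun lam u hl hu => AsymPert.linForm_bounds hn hrn hM hμ hL hsmall ha hgood ℓ hl hu
    · refine ENNReal.ofReal_le_ofReal ?_
      gcongr
      norm_num
  -- For n ≤ 2 the constant K = 2^10 makes the bound on the probability at least 1.
  · refine prob_le_one.trans ?_
    rw [ENNReal.one_le_ofReal, le_div_iff₀ (by positivity), one_mul]
    have : (n : ℝ) ≤ 2 := by exact_mod_cast (by omega : n ≤ 2)
    gcongr
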